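/- Let $n\ge 3$ and $\ell\ge 2$ be integers, let $\zeta\in\mathbb{C}$ be a primitive $\ell$-th root of unity, and let $t=(t_1,\dots,t_n)\in\mathbb{C}^n$. All subscripts are read modulo $n$. Let $V=\mathbb{C}^n$ with standard basis $x_1,\dots,x_n$ and let $G\subset SL_n(\mathbb{C})$ be the group of all diagonal matrices $g$ with $g^\ell=1$. For $1\le i\le n$ let $g_i\in G$ be the element with $g_i(x_i)=\zeta x_i$, $g_i(x_{i+1})=\zeta^{-1}x_{i+1}$ and $g_i(x_j)=x_j$ for the other $j$; every element of $G$ can be written as $g_1^{i_1}\cdots g_{n-1}^{i_{n-1}}$ with exponents unique modulo $\ell$. Let $\alpha$ be the $2$-cocycle \[ \alpha\big(g_1^{i_1}\cdots g_{n-1}^{i_{n-1}},\,g_1^{j_1}\cdots g_{n-1}^{j_{n-1}}\big)=\zeta^{-i_1j_2-i_2j_3-\dots-i_{n-2}j_{n-1}} . \] Let $TV\#_\alpha G$ be the crossed product of the tensor algebra $TV$ with $G$, that is, the vector space $TV\otimes\mathbb{C}G$ with product $(r\otimes g)(s\otimes h)=\alpha(g,h)\,r\,(g\cdot s)\otimes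 gh$; the product of $g,h\in G$ in it is written $g*h=\alpha(g,h)gh$. Let $\mathsf{H}$ be the quotient of $TV\#_\alpha G$ by the relations \[ x_ix_{i+1}-x_{i+1}x_i=t_ig_i\quad(1\le i\le n),\qquad x_ix_j-x_jx_i=0\quad\text{if } |i-j|\notin\{1,n-1\}, \] and let $\mathsf{Z}$ be its center. Let $J$ be the set of all subsets $\{i_1<\dots<i_k\}$ ($k\ge 0$) of $\{1,\dots,n\}$ such that $|i_r-i_s|\notin\{1,n-1\}$ for all $r,s$. In $\mathbb{Z}^n$ put $\delta=(1,\dots,1)$, and let $\varepsilon_i$ have entries $1$ at the positions $i$ and $i+1$ and $0$ elsewhere; write $\omega^p=\omega_1^{p_1}\cdots\omega_n^{p_n}$, with the factors in this order. Set $\tau_i=\frac{t_i}{\zeta-1}$ and $\widetilde\tau_i=\tau_i^\ell$ for $1\le i\le n-1$, $\tau_n=\frac{\zeta t_n}{\zeta-1}$ and $\widetilde\tau_n=(-1)^{n(\ell-1)}\tau_n^\ell$, and $\nu_r=(-1)^r\frac{\ell}{\ell-r}\binom{\ell-r}{r}$ for $0\le r\le\lfloor\ell/2\rfloor$. Define \[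 w=\sum_{\{i_1<\dots<i_k\}\in J}\tau_{i_1}\cdots\tau_{i_k}\,x^{\delta-\varepsilon_{i_1}-\dots-\varepsilon_{i_k}}\,g_{i_1}*\cdots*g_{i_k}\in\mathsf{H} \] and the polynomial $F\in\mathbb{C}[a_1,\dots,a_n,b]$ by \[ F=\sum_{\{i_1<\dots<i_k\}\in J}\widetilde\tau_{i_1}\cdots\widetilde\tau_{i_k}\,a^{\delta-\varepsilon_{i_1}-\dots-\varepsilon_{i_k}}-\sum_{r=0}^{\lfloor\ell/2\rfloor}(-1)^{nr}\zeta^{(n-2)r}\nu_r(\tau_1\cdots\tau_n)^r\,b^{\ell-2r}. \] Then the assignment $a_i\mapsto x_i^\ell$ ($i=1,\dots,n$), $b\mapsto w$ defines an isomorphism of $\mathbb{C}$-algebras \[ \mathbb{C}[a_1,\dots,a_n,b]/(F)\ \overset{\sim}{\longrightarrow}\ \mathsf{Z}. \] Moreover, if $t_1=\dots=t_n=0$, then $F=a_1\cdots a_n-b^\ell$. -/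

import Mathlib

noncomputable section

/-- A normalized `2`-cocycle of a group `G` with values in the units of `k` (trivial action). -/
structure NormalizedCocycle (k G : Type*) [CommRing k] [Group G] where
  toFun : G → G → kˣ
  map_one_left : ∀ g, toFun 1 g = 1
  map_one_right : ∀ g, toFun g 1 = 1
  cocycle : ∀ g h m, toFun g h * toFun (g * h) m = toFun h m * toFun g (h * m)

/-- The crossed product `E #_α G` of a `k`-algebra `E` with an action `ρ : G → Aut(E)` and a
`2`-cocycle `α`. As a `k`-module it is `E ⊗ kG`, realized as `G →₀ E`. -/
@[ext]
structure CrossedProduct {k E G : Type*} [CommRing k] [Ring E] [Algebra k E] [Group G]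
    (ρ : G →* (E ≃ₐ[k] E)) (α : NormalizedCocycle k G) where
  coeff : G →₀ E

namespace CrossedProduct

variable {k E G : Type*} [CommRing k] [Ring E] [Algebra k E] [Group G]
  {ρ : G →* (E ≃ₐ[k] E)} {α : NormalizedCocycle k G}

/-- The underlying `k`-module of the crossed product is `G →₀ E`. -/
def coeffEquiv : CrossedProduct ρ α ≃ (G →₀ E) where
  toFun := coeff
  invFun := mk

instance : AddCommGroup (CrossedProduct ρ α) := coeffEquiv.addCommGroup

instance : Module k (CrossedProduct ρ α) := coeffEquiv.module k

/-- The element `r ⊗ g`. -/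
def single (g : G) (r : E) : CrossedProduct ρ α := ⟨Finsupp.single g r⟩

/-- `(r ⊗ g) (s ⊗ h) = α(g, h) r (g · s) ⊗ g h`, extended biadditively. -/
instance : Mul (CrossedProduct ρ α) :=
  ⟨fun a b => ⟨a.coeff.sum fun g r => b.coeff.sum fun h s =>
    Finsupp.single (g * h) (α.toFun g h • (r * ρ g s))⟩⟩

instance : One (CrossedProduct ρ α) := ⟨single 1 1⟩

theorem coeff_add (a b : CrossedProduct ρ α) : (a + b).coeff = a.coeff + b.coeff := rfl

theorem coeff_zero : (0 : CrossedProduct ρ α).coeff = 0 := rfl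

theorem coeff_smul (c : k) (a : CrossedProduct ρ α) : (c • a).coeff = c • a.coeff := rfl

theorem coeff_mul (a b : CrossedProduct ρ α) :
    (a * b).coeff = a.coeff.sum fun g r => b.coeff.sum fun h s =>
      Finsupp.single (g * h) (α.toFun g h • (r * ρ g s)) := rfl

theorem one_def : (1 : CrossedProduct ρ α) = single 1 1 := rfl

theorem single_add (g : G) (r s : E) :
    (single g (r + s) : CrossedProduct ρ α) = single g r + single g s := by
  ext1; simp [single, coeff_add]

theorem single_zero (g : G) : (single g 0 : CrossedProduct ρ α) = 0 := by
  ext1; simp [single, coeff_zero]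

theorem smul_single (c : k) (g : G) (r : E) :
    c • (single g r : CrossedProduct ρ α) = single g (c • r) := by
  ext1; simp [single, coeff_smul]

theorem single_mul_single (g h : G) (r s : E) :
    (single g r * single h s : CrossedProduct ρ α) =
      single (g * h) (α.toFun g h • (r * ρ g s)) := by
  ext1
  rw [coeff_mul]
  simp [single]

@[elab_as_elim]
theorem induction_on {p : CrossedProduct ρ α → Prop} (a : CrossedProduct ρ α)
    (h0 : p 0) (hs : ∀ g r, p (single g r)) (hadd : ∀ a b, p a → p b → p (a + b)) : p a := by
  obtain ⟨f⟩ := a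
  induction f using Finsupp.induction_linear with
  | zero => exact h0
  | add f g hf hg => exact hadd _ _ hf hg
  | single g r => exact hs g r

theorem mul_add_aux (a b c : CrossedProduct ρ α) : a * (b + c) = a * b + a * c := by
  classical
  ext1
  simp only [coeff_mul, coeff_add]
  rw [← Finsupp.sum_add]
  congr 1
  funext g r
  rw [Finsupp.sum_add_index'] <;> intros <;> simp [mul_add]

theorem add_mul_aux (a b c : CrossedProduct ρ α) : (a + b) * c = a * c + b * c := by
  classical
  ext1
  simp only [coeff_mul, coeff_add]
  rw [Finsupp.sum_add_index'] <;> intros <;> simp [add_mul, Finsupp.sum_add]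

theorem zero_mul_aux (a : CrossedProduct ρ α) : 0 * a = 0 := by
  ext1; simp [coeff_mul, coeff_zero]

theorem mul_zero_aux (a : CrossedProduct ρ α) : a * 0 = 0 := by
  ext1; simp [coeff_mul, coeff_zero]

instance : Ring (CrossedProduct ρ α) where
  __ := (inferInstance : AddCommGroup (CrossedProduct ρ α))
  left_distrib := mul_add_aux
  right_distrib := add_mul_aux
  zero_mul := zero_mul_aux
  mul_zero := mul_zero_aux
  mul_assoc a b c := by
    induction a using induction_on with
    | h0 => simp only [zero_mul_aux]
    | hadd a a' h h' => simp only [add_mul_aux, h, h']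
    | hs g r =>
    induction b using induction_on with
    | h0 => simp only [zero_mul_aux, mul_zero_aux]
    | hadd a a' h h' => simp only [add_mul_aux, mul_add_aux, h, h']
    | hs h s =>
    induction c using induction_on with
    | h0 => simp only [mul_zero_aux]
    | hadd a a' h h' => simp only [mul_add_aux, h, h']
    | hs m u =>
      simp only [single_mul_single, mul_assoc]
      congr 1
      simp only [Units.smul_def, map_smul, map_mul, smul_mul_assoc, mul_smul_comm, smul_smul,
        AlgEquiv.mul_apply, mul_assoc]
      congr 1
      have := congrArg Units.val (α.cocycle g h m)
      simp only [Units.val_mul] at this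
      rw [mul_comm, this, mul_comm]
  one_mul a := by
    induction a using induction_on with
    | h0 => simp only [mul_zero_aux]
    | hadd a a' h h' => simp only [mul_add_aux, h, h']
    | hs g r => simp [one_def, single_mul_single, α.map_one_left]
  mul_one a := by
    induction a using induction_on with
    | h0 => simp only [zero_mul_aux]
    | hadd a a' h h' => simp only [add_mul_aux, h, h']
    | hs g r => simp [one_def, single_mul_single, α.map_one_right]

instance : Algebra k (CrossedProduct ρ α) :=
  Algebra.ofModule
    (fun c a b => by
      induction a using induction_on with
      | h0 => simp
      | hadd a a' h h' => simp only [add_mul, smul_add, h, h']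
      | hs g r =>
      induction b using induction_on with
      | h0 => simp
      | hadd a a' h h' => simp only [mul_add, smul_add, h, h']
      | hs h s => simp [smul_single, single_mul_single, smul_comm c])
    (fun c a b => by
      induction a using induction_on with
      | h0 => simp
      | hadd a a' h h' => simp only [add_mul, smul_add, h, h']
      | hs g r =>
      induction b using induction_on with
      | h0 => simp
      | hadd a a' h h' => simp only [mul_add, smul_add, h, h']
      | hs h s => simp [smul_single, single_mul_single, smul_comm c])

end CrossedProduct

namespace TwistedHecke

open Matrix

/-- The group `G` of all diagonal matrices `g` in `SL_n(ℂ)` with `g ^ ℓ = 1`. -/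
def diagGroup (n ℓ : ℕ) : Subgroup (SpecialLinearGroup (Fin n) ℂ) where
  carrier := {g | (g : Matrix (Fin n) (Fin n) ℂ).IsDiag ∧ g ^ ℓ = 1}
  one_mem' := ⟨by simp, one_pow _⟩
  mul_mem' := by
    rintro a b ⟨ha, ha'⟩ ⟨hb, hb'⟩
    have hc : Commute a b := by
      apply Subtype.ext
      change (a : Matrix (Fin n) (Fin n) ℂ) * b = b * a
      rw [← ha.diagonal_diag, ← hb.diagonal_diag]
      simp [mul_comm]
    refine ⟨?_, by rw [hc.mul_pow, ha', hb', one_mul]⟩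
    change ((a : Matrix (Fin n) (Fin n) ℂ) * b).IsDiag
    rw [← ha.diagonal_diag, ← hb.diagonal_diag, diagonal_mul_diagonal]
    exact isDiag_diagonal _
  inv_mem' := by
    rintro a ⟨ha, ha'⟩
    refine ⟨?_, by rw [inv_pow, ha', inv_one]⟩
    change (adjugate (a : Matrix (Fin n) (Fin n) ℂ)).IsDiag
    rw [← ha.diagonal_diag, adjugate_diagonal]
    exact isDiag_diagonal _

variable {n ℓ : ℕ}

/-- The `j`-th diagonal entry of `g`. -/
def entry (g : diagGroup n ℓ) (j : Fin n) : ℂ := (g : SpecialLinearGroup (Fin n) ℂ) j j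

theorem coe_eq_diagonal (g : diagGroup n ℓ) :
    ((g : SpecialLinearGroup (Fin n) ℂ) : Matrix (Fin n) (Fin n) ℂ) = diagonal (entry g) :=
  g.2.1.diagonal_diag.symm

theorem entry_one (j : Fin n) : entry (1 : diagGroup n ℓ) j = 1 := by
  simp [entry]

theorem entry_mul (g h : diagGroup n ℓ) (j : Fin n) : entry (g * h) j = entry g j * entry h j := by
  have : ((g * h : diagGroup n ℓ) : SpecialLinearGroup (Fin n) ℂ).1 =
      diagonal (entry g) * diagonal (entry h) := by
    rw [← coe_eq_diagonal, ← coe_eq_diagonal]; rfl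
  rw [diagonal_mul_diagonal] at this
  have h2 := congrFun (congrFun this j) j
  rwa [diagonal_apply_eq] at h2

theorem ext_entry {g h : diagGroup n ℓ} (H : ∀ j, entry g j = entry h j) : g = h := by
  apply Subtype.ext
  apply Subtype.ext
  rw [coe_eq_diagonal, coe_eq_diagonal, funext H]

instance : CommGroup (diagGroup n ℓ) where
  mul_comm g h := ext_entry fun j => by rw [entry_mul, entry_mul, mul_comm]

theorem entry_pow (g : diagGroup n ℓ) (m : ℕ) (j : Fin n) : entry (g ^ m) j = entry g j ^ m := by
  induction m with
  | zero => simp [entry_one]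
  | succ m ih => rw [pow_succ, entry_mul, ih, pow_succ]

theorem entry_pow_card (g : diagGroup n ℓ) (j : Fin n) : entry g j ^ ℓ = 1 := by
  have : g ^ ℓ = 1 := Subtype.ext g.2.2
  rw [← entry_pow, this, entry_one]

/-- The product of the first `k + 1` diagonal entries of `g`. -/
def partialProd (g : diagGroup n ℓ) (k : ℕ) : ℂ :=
  ∏ j : Fin n with j.val ≤ k, entry g j

theorem partialProd_one (k : ℕ) : partialProd (1 : diagGroup n ℓ) k = 1 := by
  simp [partialProd, entry_one]

theorem partialProd_mul (g h : diagGroup n ℓ) (k : ℕ) :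
    partialProd (g * h) k = partialProd g k * partialProd h k := by
  simp [partialProd, entry_mul, Finset.prod_mul_distrib]

theorem partialProd_pow_card (g : diagGroup n ℓ) (k : ℕ) : partialProd g k ^ ℓ = 1 := by
  simp [partialProd, ← Finset.prod_pow, entry_pow_card]

/-- The action of `G` on the tensor algebra `TV` of `V = ℂ^n` induced by the action on `V`. -/
def tensorAction (n ℓ : ℕ) : diagGroup n ℓ →*
    (TensorAlgebra ℂ (Fin n → ℂ) ≃ₐ[ℂ] TensorAlgebra ℂ (Fin n → ℂ)) :=
  let f : diagGroup n ℓ → (TensorAlgebra ℂ (Fin n → ℂ) →ₐ[ℂ] TensorAlgebra ℂ (Fin n → ℂ)) :=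
    fun g => TensorAlgebra.lift ℂ ((TensorAlgebra.ι ℂ).comp
      (SpecialLinearGroup.toLin' (g : SpecialLinearGroup (Fin n) ℂ)).toLinearMap)
  have hmul : ∀ g h, f (g * h) = (f g).comp (f h) := fun g h => by
    apply TensorAlgebra.hom_ext
    refine LinearMap.ext fun v => ?_
    simp [f]
  have hone : f 1 = AlgHom.id ℂ _ := by
    apply TensorAlgebra.hom_ext
    refine LinearMap.ext fun v => ?_
    simp [f]
  { toFun := fun g => AlgEquiv.ofAlgHom (f g) (f g⁻¹)
      (by rw [← hmul, mul_inv_cancel, hone]) (by rw [← hmul, inv_mul_cancel, hone])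
    map_one' := by
      ext a
      exact DFunLike.congr_fun hone a
    map_mul' := fun g h => by
      ext a
      exact DFunLike.congr_fun (hmul g h) a }

theorem tensorAction_ι (g : diagGroup n ℓ) (v : Fin n → ℂ) :
    tensorAction n ℓ g (TensorAlgebra.ι ℂ v) = TensorAlgebra.ι ℂ
      (((g : SpecialLinearGroup (Fin n) ℂ) : Matrix (Fin n) (Fin n) ℂ) *ᵥ v) := by
  simp [tensorAction, SpecialLinearGroup.toLin'_apply]

variable [NeZero ℓ] {ζ : ℂ}

/-- `ζ` as a unit of `ℂ`. -/
def zetaUnit (hζ : IsPrimitiveRoot ζ ℓ) : ℂˣ := Units.mk0 ζ (hζ.ne_zero (NeZero.ne ℓ))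

theorem coe_zetaUnit (hζ : IsPrimitiveRoot ζ ℓ) : (zetaUnit hζ : ℂ) = ζ := rfl

theorem exists_exponent (hζ : IsPrimitiveRoot ζ ℓ) (g : diagGroup n ℓ) (k : ℕ) :
    ∃ i : ℕ, ζ ^ i = partialProd g k := by
  obtain ⟨i, -, hi⟩ := hζ.eq_pow_of_pow_eq_one (partialProd_pow_card g k)
  exact ⟨i, hi⟩

/-- The exponent (unique modulo `ℓ`) of `g_k` in the expression of `g` as a product of powers of
`g_0, …, g_{n-2}`. It is read off the diagonal entries: the product of the first `k + 1` diagonal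
entries of `g_0 ^ {i_0} ⋯ g_{n-2} ^ {i_{n-2}}` is `ζ ^ {i_k}`. See `prod_gen_pow_exponent`. -/
def exponent (hζ : IsPrimitiveRoot ζ ℓ) (g : diagGroup n ℓ) (k : ℕ) : ℕ :=
  (exists_exponent hζ g k).choose

theorem zeta_pow_exponent (hζ : IsPrimitiveRoot ζ ℓ) (g : diagGroup n ℓ) (k : ℕ) :
    ζ ^ exponent hζ g k = partialProd g k := (exists_exponent hζ g k).choose_spec

theorem zetaUnit_pow_exponent_one (hζ : IsPrimitiveRoot ζ ℓ) (k : ℕ) :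
    zetaUnit hζ ^ exponent hζ (1 : diagGroup n ℓ) k = 1 := by
  apply Units.ext
  rw [Units.val_pow_eq_pow_val, coe_zetaUnit, zeta_pow_exponent, partialProd_one, Units.val_one]

theorem zetaUnit_pow_exponent_mul (hζ : IsPrimitiveRoot ζ ℓ) (g h : diagGroup n ℓ) (k : ℕ) :
    zetaUnit hζ ^ exponent hζ (g * h) k =
      zetaUnit hζ ^ exponent hζ g k * zetaUnit hζ ^ exponent hζ h k := by
  apply Units.ext
  simp only [Units.val_mul, Units.val_pow_eq_pow_val, coe_zetaUnit, zeta_pow_exponent,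
    partialProd_mul]

/-- `α(g_0^{i_0} ⋯ g_{n-2}^{i_{n-2}}, g_0^{j_0} ⋯ g_{n-2}^{j_{n-2}})
  = ζ ^ (- i_0 j_1 - i_1 j_2 - ⋯ - i_{n-3} j_{n-2})`, with indices starting at `0`. -/
def cocycleFun (hζ : IsPrimitiveRoot ζ ℓ) (g h : diagGroup n ℓ) : ℂˣ :=
  zetaUnit hζ ^
    (-∑ k ∈ Finset.range (n - 2), (exponent hζ g k : ℤ) * (exponent hζ h (k + 1) : ℤ))

theorem cocycleFun_eq (hζ : IsPrimitiveRoot ζ ℓ) (g h : diagGroup n ℓ) :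
    cocycleFun hζ g h = (∏ k ∈ Finset.range (n - 2),
      zetaUnit hζ ^ (exponent hζ g k * exponent hζ h (k + 1)))⁻¹ := by
  rw [cocycleFun, _root_.zpow_neg, Finset.prod_pow_eq_pow_sum, ← zpow_natCast]
  push_cast
  rfl

theorem cocycleFun_mul_left (hζ : IsPrimitiveRoot ζ ℓ) (g g' h : diagGroup n ℓ) :
    cocycleFun hζ (g * g') h = cocycleFun hζ g h * cocycleFun hζ g' h := by
  simp only [cocycleFun_eq, pow_mul, zetaUnit_pow_exponent_mul, mul_pow, Finset.prod_mul_distrib,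
    mul_inv]

theorem cocycleFun_mul_right (hζ : IsPrimitiveRoot ζ ℓ) (g h h' : diagGroup n ℓ) :
    cocycleFun hζ g (h * h') = cocycleFun hζ g h * cocycleFun hζ g h' := by
  simp only [cocycleFun_eq, pow_mul', zetaUnit_pow_exponent_mul, mul_pow,
    Finset.prod_mul_distrib, mul_inv]

/-- The `2`-cocycle `α` of `G`. -/
def cocycle (n : ℕ) (hζ : IsPrimitiveRoot ζ ℓ) : NormalizedCocycle ℂ (diagGroup n ℓ) where
  toFun := cocycleFun hζ
  map_one_left g := by
    simp only [cocycleFun_eq, pow_mul, zetaUnit_pow_exponent_one, one_pow, Finset.prod_const_one,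
      inv_one]
  map_one_right g := by
    simp only [cocycleFun_eq, pow_mul', zetaUnit_pow_exponent_one, one_pow, Finset.prod_const_one,
      inv_one]
  cocycle g h m := by
    rw [cocycleFun_mul_left, cocycleFun_mul_right, ← mul_assoc, mul_comm]

/-- The crossed product `TV #_α G`. -/
abbrev TensorCrossed (n : ℕ) (hζ : IsPrimitiveRoot ζ ℓ) : Type :=
  CrossedProduct (tensorAction n ℓ) (cocycle n hζ)

/-- `x_i`, the `i`-th standard basis vector of `V`, in `TV #_α G`. -/
def preX (hζ : IsPrimitiveRoot ζ ℓ) (i : Fin n) : TensorCrossed n hζ :=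
  CrossedProduct.single 1 (TensorAlgebra.ι ℂ (Pi.single i 1))

/-- A group element `g` in `TV #_α G`. -/
def preG (hζ : IsPrimitiveRoot ζ ℓ) (g : diagGroup n ℓ) : TensorCrossed n hζ :=
  CrossedProduct.single g 1

variable [NeZero n]

/-- The element `g_i` of `G`: it multiplies `x_i` by `ζ`, `x_{i+1}` by `ζ⁻¹`, and fixes the other
`x_j`. Indices are elements of `Fin n = {0, …, n - 1}`, and `i + 1` is taken modulo `n`. -/
def gen (hζ : IsPrimitiveRoot ζ ℓ) (i : Fin n) : diagGroup n ℓ :=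
  ⟨(⟨diagonal fun j => (if j = i then ζ else 1) * (if j = i + 1 then ζ⁻¹ else 1), by
      rw [det_diagonal, Finset.prod_mul_distrib]
      simp [hζ.ne_zero (NeZero.ne ℓ)]⟩ : SpecialLinearGroup (Fin n) ℂ), isDiag_diagonal _, by
      apply Subtype.ext
      change (diagonal _ : Matrix (Fin n) (Fin n) ℂ) ^ ℓ = 1
      rw [diagonal_pow, ← diagonal_one]
      congr 1
      funext j
      simp only [Pi.pow_apply, mul_pow, ite_pow, inv_pow, hζ.pow_eq_one]
      simp⟩

theorem entry_gen (hζ : IsPrimitiveRoot ζ ℓ) (i j : Fin n) :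
    entry (gen hζ i) j = (if j = i then ζ else 1) * (if j = i + 1 then ζ⁻¹ else 1) :=
  diagonal_apply_eq _ _

theorem partialProd_gen (hζ : IsPrimitiveRoot ζ ℓ) {k : ℕ} (hk : k + 1 < n) (m : ℕ) :
    partialProd (gen hζ (Fin.ofNat n k)) m = if m = k then ζ else 1 := by
  have h0 := hζ.ne_zero (NeZero.ne ℓ)
  have hk1 : (Fin.ofNat n k).val = k := Nat.mod_eq_of_lt (by omega)
  have hk2 : (Fin.ofNat n k + 1).val = k + 1 := by
    rw [Fin.val_add, hk1, Fin.val_one', Nat.add_mod_mod, Nat.mod_eq_of_lt hk]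
  simp only [partialProd, entry_gen, Finset.prod_mul_distrib, Finset.prod_ite_eq',
    Finset.mem_filter, Finset.mem_univ, true_and, hk1, hk2]
  split_ifs <;> first | omega | simp [h0]

theorem partialProd_prod_gen (hζ : IsPrimitiveRoot ζ ℓ) (i : ℕ → ℤ) {m : ℕ} (hm : m + 1 < n) :
    partialProd (∏ k ∈ Finset.range (n - 1), gen hζ (Fin.ofNat n k) ^ i k) m = ζ ^ i m := by
  let f : diagGroup n ℓ →* ℂ :=
    { toFun := fun g => partialProd g m
      map_one' := partialProd_one m
      map_mul' := fun g h => partialProd_mul g h m }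
  change f _ = _
  rw [map_prod, Finset.prod_eq_single m]
  · rw [map_zpow]
    change partialProd _ m ^ _ = _
    rw [partialProd_gen hζ hm, if_pos rfl]
  · intro k hk hkm
    rw [Finset.mem_range] at hk
    rw [map_zpow]
    change partialProd _ m ^ _ = _
    rw [partialProd_gen hζ (by omega), if_neg (Ne.symm hkm), _root_.one_zpow]
  · intro h
    rw [Finset.mem_range] at h
    omega

theorem zetaUnit_pow_exponent_prod_gen (hζ : IsPrimitiveRoot ζ ℓ) (i : ℕ → ℤ) {m : ℕ}
    (hm : m + 1 < n) :
    zetaUnit hζ ^ exponent hζ (∏ k ∈ Finset.range (n - 1), gen hζ (Fin.ofNat n k) ^ i k) m =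
      zetaUnit hζ ^ i m := by
  apply Units.ext
  rw [Units.val_pow_eq_pow_val, Units.val_zpow_eq_zpow_val, coe_zetaUnit, zeta_pow_exponent,
    partialProd_prod_gen hζ i hm]

/-- The expression of `g` as a product of powers of `g_0, …, g_{n-2}`. -/
theorem prod_gen_pow_exponent (hζ : IsPrimitiveRoot ζ ℓ) (g : diagGroup n ℓ) :
    ∏ k ∈ Finset.range (n - 1), gen hζ (Fin.ofNat n k) ^ exponent hζ g k = g := by
  set h := ∏ k ∈ Finset.range (n - 1), gen hζ (Fin.ofNat n k) ^ exponent hζ g k with hh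
  have hlast : ∀ u : diagGroup n ℓ, partialProd u (n - 1) = 1 := fun u => by
    have h1 := (u : SpecialLinearGroup (Fin n) ℂ).2
    rw [coe_eq_diagonal, det_diagonal] at h1
    rw [partialProd, Finset.filter_true_of_mem (fun j _ => by omega), h1]
  have key : ∀ m < n, partialProd h m = partialProd g m := fun m hm => by
    rcases Nat.lt_or_ge (m + 1) n with hm' | hm'
    · have h1 := partialProd_prod_gen hζ (fun k => (exponent hζ g k : ℤ)) hm'
      simp only [zpow_natCast] at h1
      rw [hh, h1, zeta_pow_exponent]
    · obtain rfl : m = n - 1 := by omega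
      rw [hlast, hlast]
  have hsucc : ∀ (u : diagGroup n ℓ) (m : ℕ) (hm : m + 1 < n),
      partialProd u (m + 1) = entry u ⟨m + 1, hm⟩ * partialProd u m := fun u m hm => by
    rw [partialProd, partialProd, ← Finset.prod_insert (by simp)]
    congr 1
    ext j
    simp [Fin.ext_iff]
    omega
  apply ext_entry
  rintro ⟨m, hm⟩
  cases m with
  | zero =>
    have hz : ∀ u : diagGroup n ℓ, partialProd u 0 = entry u ⟨0, hm⟩ := fun u => by
      rw [partialProd, Finset.prod_eq_single ⟨0, hm⟩]
      · intro j hj hj'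
        exact absurd (Fin.ext (Nat.le_zero.mp (Finset.mem_filter.mp hj).2)) hj'
      · simp
    rw [← hz, ← hz, key 0 hm]
  | succ m =>
    have h1 := key (m + 1) hm
    rw [hsucc h m hm, hsucc g m hm, key m (by omega)] at h1
    refine mul_right_cancel₀ (fun h0 => ?_) h1
    have h2 := partialProd_pow_card g m
    rw [h0, zero_pow (NeZero.ne ℓ)] at h2
    exact zero_ne_one h2

/-- The defining formula of the cocycle `α`. -/
theorem cocycleFun_prod_gen (hζ : IsPrimitiveRoot ζ ℓ) (i j : ℕ → ℤ) :
    cocycleFun hζ (∏ k ∈ Finset.range (n - 1), gen hζ (Fin.ofNat n k) ^ i k)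
      (∏ k ∈ Finset.range (n - 1), gen hζ (Fin.ofNat n k) ^ j k) =
    zetaUnit hζ ^ (-∑ k ∈ Finset.range (n - 2), i k * j (k + 1)) := by
  rw [cocycleFun_eq, _root_.zpow_neg]
  congr 1
  have hsum : ∀ (s : Finset ℕ) (f : ℕ → ℤ),
      zetaUnit hζ ^ (∑ k ∈ s, f k) = ∏ k ∈ s, zetaUnit hζ ^ f k := fun s f => by
    classical
    induction s using Finset.induction_on with
    | empty => simp
    | insert a s ha ih => rw [Finset.sum_insert ha, Finset.prod_insert ha, _root_.zpow_add, ih]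
  rw [hsum]
  refine Finset.prod_congr rfl fun k hk => ?_
  rw [Finset.mem_range] at hk
  rw [pow_mul, zetaUnit_pow_exponent_prod_gen hζ i (by omega), ← zpow_natCast, ← _root_.zpow_mul,
    mul_comm, _root_.zpow_mul, zpow_natCast, zetaUnit_pow_exponent_prod_gen hζ j (by omega),
    ← _root_.zpow_mul, mul_comm]

/-- `|i - j| ∉ {1, n - 1}`. -/
def NonAdjacent (i j : Fin n) : Prop :=
  |(i : ℤ) - (j : ℤ)| ≠ 1 ∧ |(i : ℤ) - (j : ℤ)| ≠ (n : ℤ) - 1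

instance (i j : Fin n) : Decidable (NonAdjacent i j) := by
  unfold NonAdjacent; infer_instance

/-- The defining relations of `H`. -/
inductive HeckeRel (hζ : IsPrimitiveRoot ζ ℓ) (t : Fin n → ℂ) :
    TensorCrossed n hζ → TensorCrossed n hζ → Prop
  | adjacent (i : Fin n) : HeckeRel hζ t
      (preX hζ i * preX hζ (i + 1) - preX hζ (i + 1) * preX hζ i) (t i • preG hζ (gen hζ i))
  | nonAdjacent (i j : Fin n) (h : NonAdjacent i j) : HeckeRel hζ t
      (preX hζ i * preX hζ j - preX hζ j * preX hζ i) 0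

/-- The twisted graded Hecke algebra `H`, the quotient of `TV #_α G` by the relations. -/
abbrev Hecke (hζ : IsPrimitiveRoot ζ ℓ) (t : Fin n → ℂ) : Type := RingQuot (HeckeRel hζ t)

/-- The image of `x_i` in `H`. -/
def heckeX (hζ : IsPrimitiveRoot ζ ℓ) (t : Fin n → ℂ) (i : Fin n) : Hecke hζ t :=
  RingQuot.mkAlgHom ℂ (HeckeRel hζ t) (preX hζ i)

/-- The image of `g_i` in `H`. -/
def heckeG (hζ : IsPrimitiveRoot ζ ℓ) (t : Fin n → ℂ) (i : Fin n) : Hecke hζ t :=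
  RingQuot.mkAlgHom ℂ (HeckeRel hζ t) (preG hζ (gen hζ i))

/-- The set `J` of subsets of the index set without two cyclically adjacent elements. -/
def indexJ (n : ℕ) [NeZero n] : Finset (Finset (Fin n)) :=
  Finset.univ.filter fun S => ∀ r ∈ S, ∀ s ∈ S, NonAdjacent r s

/-- `ε_i`, the integer vector with entries `1` at `i` and `i + 1` (modulo `n`), `0` elsewhere. -/
def epsilon (i : Fin n) : Fin n → ℤ := fun j => if j = i ∨ j = i + 1 then 1 else 0

/-- The vector `δ - ∑_{i ∈ S} ε_i`. -/
def deltaSub (S : Finset (Fin n)) : Fin n → ℤ := fun j => 1 - ∑ i ∈ S, epsilon i j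

theorem deltaSub_nonneg {S : Finset (Fin n)} (hS : S ∈ indexJ n) (j : Fin n) :
    0 ≤ deltaSub S j := by
  have hS' : ∀ r ∈ S, ∀ s ∈ S, NonAdjacent r s := (Finset.mem_filter.mp hS).2
  have hcard : (S.filter fun i => j = i ∨ j = i + 1).card ≤ 1 := by
    rw [Finset.card_le_one]
    have hadj : ∀ i : Fin n, i + 1 = i ∨ ¬ NonAdjacent (i + 1) i := fun i => by
      have hi := i.2
      have hv : (i + 1).val = (i.val + 1) % n := by
        rw [Fin.val_add, Fin.val_one', Nat.add_mod_mod]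
      rcases Nat.lt_or_ge (i.val + 1) n with h | h
      · right
        rw [Nat.mod_eq_of_lt h] at hv
        rintro ⟨h1, -⟩
        apply h1
        rw [hv]
        simp
      · have h' : i.val + 1 = n := by omega
        rw [h', Nat.mod_self] at hv
        right
        rintro ⟨-, h2⟩
        apply h2
        rw [hv, abs_sub_comm, abs_of_nonneg] <;> omega
    intro a ha b hb
    rw [Finset.mem_filter] at ha hb
    obtain ⟨haS, ha⟩ := ha
    obtain ⟨hbS, hb⟩ := hb
    rcases ha with rfl | ha <;> rcases hb with rfl | hb
    · rfl
    · rcases hadj b with h | h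
      · rw [hb, h]
      · exact absurd (hS' _ (hb ▸ haS) _ hbS) h
    · rcases hadj a with h | h
      · rw [ha, h]
      · exact absurd (hS' _ (ha ▸ hbS) _ haS) h
    · exact add_right_cancel (ha.symm.trans hb)
  have hsum : ∑ i ∈ S, epsilon i j = ((S.filter fun i => j = i ∨ j = i + 1).card : ℤ) := by
    simp [epsilon]
  rw [deltaSub, hsum]
  omega

/-- `τ_i = t_i / (ζ - 1)`, except that the last one is `ζ t_i / (ζ - 1)`. -/
def tau (ζ : ℂ) (t : Fin n → ℂ) (i : Fin n) : ℂ :=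
  if (i : ℕ) + 1 = n then ζ * t i / (ζ - 1) else t i / (ζ - 1)

/-- `τ̃_i = τ_i ^ ℓ`, except that the last one is `(-1) ^ (n (ℓ - 1)) τ_i ^ ℓ`. -/
def tauTilde (ℓ : ℕ) (ζ : ℂ) (t : Fin n → ℂ) (i : Fin n) : ℂ :=
  if (i : ℕ) + 1 = n then (-1) ^ (n * (ℓ - 1)) * tau ζ t i ^ ℓ else tau ζ t i ^ ℓ

/-- `ν_r = (-1) ^ r (ℓ / (ℓ - r)) binom(ℓ - r, r)` for `0 ≤ r ≤ ℓ / 2`. -/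
def nu (ℓ r : ℕ) : ℂ := (-1) ^ r * ((ℓ : ℂ) / ((ℓ : ℂ) - (r : ℂ))) * ((ℓ - r).choose r : ℂ)

/-- The element `w = ∑_{S ∈ J} (∏_{i ∈ S} τ_i) x ^ (δ - ∑_{i ∈ S} ε_i) g_{i_1} * ⋯ * g_{i_k}` of
`H`. Both products of noncommuting factors are taken in increasing order of the indices; the
exponents are nonnegative, see `deltaSub_nonneg`. -/
def heckeW (hζ : IsPrimitiveRoot ζ ℓ) (t : Fin n → ℂ) : Hecke hζ t :=
  ∑ S ∈ indexJ n, (∏ i ∈ S, tau ζ t i) •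
    ((List.ofFn fun j => heckeX hζ t j ^ (deltaSub S j).toNat).prod *
      (S.sort.map (heckeG hζ t)).prod)

/-- The polynomial `F`; the variable `a_i` is `X (some i)`, the variable `b` is `X none`. -/
def relF (ℓ : ℕ) (ζ : ℂ) (t : Fin n → ℂ) : MvPolynomial (Option (Fin n)) ℂ :=
  (∑ S ∈ indexJ n, MvPolynomial.C (∏ i ∈ S, tauTilde ℓ ζ t i) *
      ∏ j, MvPolynomial.X (some j) ^ (deltaSub S j).toNat) -
    ∑ r ∈ Finset.range (ℓ / 2 + 1),
      MvPolynomial.C ((-1) ^ (n * r) * ζ ^ ((n - 2) * r) * nu ℓ r * (∏ i, tau ζ t i) ^ r) *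
        MvPolynomial.X none ^ (ℓ - 2 * r)

end TwistedHecke

end

/-!
Let `𝕋` be the quantum torus spanned by the products of Laurent monomials in commuting variables
`X_1, …, X_n` with elements of `G`, and put `Y_i = t_i / (ζ - 1) X_i⁻¹ g_i`. Then
`x_i ↦ X_i - Y_{i-1}`, `g ↦ g` defines a homomorphism `H → 𝕋`. It is injective, because the ordered
monomials times elements of `G` span `H` and have distinct leading terms in `𝕋`, and so the center
of `H` can be computed in `𝕋`.

The image of `w` is found by expanding the ordered product of the `x_i`. The expansion has one term
for each `D ⊆ ℤ/n`, the set of factors contributing `X_j`. A set `S ∈ J` contributes corrections to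
the terms whose runs of consecutive elements of `D` end at all `i ∈ S`, up to the sign
`(-1) ^ |S|`. By inclusion-exclusion only the terms without such an end survive, those of `D = ∅`
and `D = ℤ/n`, and `w ↦ X_1 ⋯ X_n + (-1) ^ n Y_1 ⋯ Y_n`. On the other hand
`x_i ^ ℓ ↦ X_i ^ ℓ - tauTilde_{i-1} X_{i-1} ^ (-ℓ)`, because
`∏_{k < ℓ} (1 - ζ ^ (-k) T) = 1 - T ^ ℓ`.
The first sum in `F` is therefore the same expansion in commuting variables, with value
`U ^ ℓ + V ^ ℓ` for the two summands `U`, `V` of the image of `w`, and the second sum is the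
expression of `U ^ ℓ + V ^ ℓ` as a polynomial in `U + V` and `U V`.

Leading terms finish the proof. Up to sign `F` is monic of degree `ℓ` in `b`, and the monomials of
degree less than `ℓ` in `b` have distinct leading terms in `𝕋`; this gives the kernel. The leading
terms of a central element are monomials with nonnegative exponents invariant under `G`, so their
exponents are all congruent modulo `ℓ`, and each is the leading term of a monomial in the
`x_i ^ ℓ` and `w`; this gives surjectivity.
-/

noncomputable section

namespace CrossedProduct

variable {k E G B : Type*} [CommRing k] [Ring E] [Algebra k E] [Group G] [Ring B] [Algebra k B]
  {ρ : G →* (E ≃ₐ[k] E)} {α : NormalizedCocycle k G}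

/-- The universal property of the crossed product. -/
def lift (f : E →ₐ[k] B) (u : G → B) (hu_one : u 1 = 1)
    (hu_mul : ∀ g h, u g * u h = (α.toFun g h : k) • u (g * h))
    (hcomm : ∀ g e, u g * f e = f (ρ g e) * u g) : CrossedProduct ρ α →ₐ[k] B :=
  let F : CrossedProduct ρ α →ₗ[k] B :=
    { toFun := fun a => a.coeff.sum fun g r => f r * u g
      map_add' := fun a b => by
        classical
        rw [coeff_add, Finsupp.sum_add_index'] <;> intros <;> simp [add_mul]
      map_smul' := fun c a => by
        rw [coeff_smul, Finsupp.sum_smul_index' (by simp), RingHom.id_apply, Finsupp.smul_sum]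
        simp }
  have hF : ∀ g r, F (single g r) = f r * u g := fun g r => by
    change Finsupp.sum (Finsupp.single g r) (fun g r => f r * u g) = _
    simp
  AlgHom.ofLinearMap F (by rw [one_def, hF, hu_one, map_one, one_mul])
    fun a b => by
    induction a using induction_on with
    | h0 => simp
    | hadd a a' h h' => simp only [add_mul, map_add, h, h']
    | hs g r =>
    induction b using induction_on with
    | h0 => simp
    | hadd a a' h h' => simp only [mul_add, map_add, h, h']
    | hs h s =>
      rw [single_mul_single, hF, hF, hF, mul_assoc (f r), ← mul_assoc (u g), hcomm, mul_assoc,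
        hu_mul, Units.smul_def, map_smul, map_mul]
      simp [mul_assoc]

theorem lift_single (f : E →ₐ[k] B) (u : G → B) (hu_one : u 1 = 1)
    (hu_mul : ∀ g h, u g * u h = (α.toFun g h : k) • u (g * h))
    (hcomm : ∀ g e, u g * f e = f (ρ g e) * u g) (g : G) (r : E) :
    lift f u hu_one hu_mul hcomm (single g r) = f r * u g := by
  change Finsupp.sum (Finsupp.single g r) (fun g r => f r * u g) = _
  simp

/-- The inclusion of the coefficient algebra in the crossed product. -/
def inclusion : E →ₐ[k] CrossedProduct ρ α :=
  AlgHom.ofLinearMap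
    { toFun := single 1
      map_add' := single_add 1
      map_smul' := fun c r => (smul_single c 1 r).symm }
    rfl fun r s => by simp [single_mul_single, α.map_one_left]

theorem single_eq_inclusion_mul (g : G) (r : E) :
    (single g r : CrossedProduct ρ α) = inclusion r * single g 1 := by
  change _ = single 1 r * single g 1
  rw [single_mul_single, map_one, α.map_one_left, one_smul, one_mul, mul_one]

/-- The coefficients of an element of the crossed product, as a linear map. -/
def coeffLinear : CrossedProduct ρ α →ₗ[k] (G →₀ E) where
  toFun := coeff
  map_add' _ _ := rfl
  map_smul' _ _ := rfl

end CrossedProduct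

namespace TwistedHecke

variable {n : ℕ}

section OrderedProduct

theorem prod_ofFn_eq_prod_update_mul {M : Type*} [Monoid M] {n : ℕ} {f : Fin n → M} {p : Fin n}
    (h : ∀ j, p < j → Commute (f p) (f j)) :
    (List.ofFn f).prod = (List.ofFn (Function.update f p 1)).prod * f p := by
  induction n with
  | zero => exact p.elim0
  | succ n ih =>
    rw [List.ofFn_succ, List.ofFn_succ, List.prod_cons, List.prod_cons]
    cases p using Fin.cases with
    | zero =>
      have hcomm : Commute (f 0) (List.ofFn fun i : Fin n => f i.succ).prod :=
        Commute.list_prod_right _ _ fun x hx => by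
          obtain ⟨i, rfl⟩ := (List.mem_ofFn' _ _).1 hx
          exact h _ i.succ_pos
      simpa using hcomm.eq
    | succ p =>
      have htail : (fun i : Fin n => Function.update f p.succ 1 i.succ) =
          Function.update (fun i => f i.succ) p 1 := by
        ext i
        simp [Function.update_apply]
      rw [htail, ih fun j hj => h _ (Fin.succ_lt_succ_iff.2 hj),
        Function.update_of_ne (Fin.succ_ne_zero p).symm, mul_assoc]

theorem prod_ofFn_eq_prod_update_update_mul {M : Type*} [Monoid M] {f : Fin n → M}
    {p q : Fin n} (hpq : p < q) (hp : ∀ j, p < j → j ≠ q → Commute (f p) (f j))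
    (hq : ∀ j, q < j → Commute (f q) (f j)) :
    (List.ofFn f).prod =
      (List.ofFn (Function.update (Function.update f q 1) p 1)).prod * (f p * f q) := by
  rw [prod_ofFn_eq_prod_update_mul hq, prod_ofFn_eq_prod_update_mul (p := p),
    Function.update_of_ne hpq.ne, mul_assoc]
  intro j hj
  rw [Function.update_of_ne hpq.ne, Function.update_apply]
  split_ifs with hjq
  · exact Commute.one_right _
  · exact hp j hj hjq

end OrderedProduct

section IndexSet

variable [NeZero n]

theorem deltaSub_toNat (S : Finset (Fin n)) (j : Fin n) :
    (deltaSub S j).toNat = if j ∈ S ∨ j - 1 ∈ S then 0 else 1 := by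
  have hsum : ∑ i ∈ S, epsilon i j = ((S.filter fun i => i = j ∨ i = j - 1).card : ℤ) := by
    simp [epsilon, eq_sub_iff_add_eq, eq_comm]
  rw [deltaSub, hsum]
  split_ifs with h
  · have : 0 < (S.filter fun i => i = j ∨ i = j - 1).card := by
      simpa [Finset.card_pos, Finset.filter_nonempty_iff, and_or_left, exists_or] using h
    lia
  · have : S.filter (fun i => i = j ∨ i = j - 1) = ∅ := by
      rw [Finset.filter_eq_empty_iff]
      rintro i hi (rfl | rfl)
      exacts [h (Or.inl hi), h (Or.inr hi)]
    simp [this]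

theorem val_add_one (i : Fin n) : (i + 1).val = if i.val + 1 = n then 0 else i.val + 1 := by
  have hi := i.isLt
  rw [Fin.val_add, Fin.val_one', Nat.add_mod_mod]
  split_ifs with h
  · rw [h, Nat.mod_self]
  · exact Nat.mod_eq_of_lt (by lia)

theorem nonAdjacent_iff (hn : 3 ≤ n) (i j : Fin n) : NonAdjacent i j ↔ i + 1 ≠ j ∧ j + 1 ≠ i := by
  have hi := i.isLt
  have hj := j.isLt
  rw [NonAdjacent, Ne, Ne, Ne, Ne, Fin.ext_iff, Fin.ext_iff, val_add_one, val_add_one,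
    abs_eq zero_le_one, abs_eq (by lia)]
  split_ifs <;> lia

theorem mem_indexJ (hn : 3 ≤ n) (S : Finset (Fin n)) : S ∈ indexJ n ↔ ∀ i ∈ S, i + 1 ∉ S := by
  simp only [indexJ, Finset.mem_filter, Finset.mem_univ, true_and, nonAdjacent_iff hn]
  constructor
  · exact fun h i hi hi' => (h i hi _ hi').1 rfl
  · exact fun h i hi j hj => ⟨fun hij => h i hi (hij ▸ hj), fun hji => h j hj (hji ▸ hi)⟩

/-- The positions of `D` at which a cyclic run of consecutive elements of `D` ends. -/
def runEnds (D : Finset (Fin n)) : Finset (Fin n) := D.filter fun i => i + 1 ∉ D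

theorem runEnds_eq_empty_iff {D : Finset (Fin n)} :
    runEnds D = ∅ ↔ D = ∅ ∨ D = Finset.univ := by
  simp only [runEnds, Finset.filter_eq_empty_iff, not_not]
  constructor
  · intro h
    refine D.eq_empty_or_nonempty.imp_right fun ⟨i, hi⟩ => Finset.eq_univ_iff_forall.2 fun j => ?_
    have hmem : ∀ k : ℕ, i + Fin.ofNat n k ∈ D := fun k => by
      induction k with
      | zero => simpa using hi
      | succ k ih =>
        have := h ih
        rwa [add_assoc, show Fin.ofNat n k + 1 = Fin.ofNat n (k + 1) from by
          ext; simp [Fin.val_add]] at this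
    simpa using hmem (j - i).val
  · rintro (rfl | rfl) <;> simp

theorem mem_indexJ_of_subset_runEnds (hn : 3 ≤ n) {S D : Finset (Fin n)} (h : S ⊆ runEnds D) :
    S ∈ indexJ n :=
  (mem_indexJ hn S).2 fun _ hi hi' =>
    (Finset.mem_filter.1 (h hi)).2 (Finset.mem_filter.1 (h hi')).1

end IndexSet

section CyclicContinuant

variable [NeZero n] {R : Type*} [Ring R]

/-- The choice, for each factor of `∏ j, (X j - Y (j - 1))`, of its first summand at `j ∈ D` and of
its second summand elsewhere. -/
def binomialChoice (X Y : Fin n → R) (D : Finset (Fin n)) : Fin n → R :=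
  D.piecewise X fun j => -Y (j - 1)

/-- The family `f` with value `1` at the vertices of the cycle covered by an edge `{i, i + 1}` with
`i ∈ S`. -/
def uncoveredFactor (f : Fin n → R) (S : Finset (Fin n)) : Fin n → R :=
  fun j => if j ∈ S ∨ j - 1 ∈ S then 1 else f j

/-- The ordered product of the `f j` over the vertices `j` of the cycle not covered by an edge
`{i, i + 1}` with `i ∈ S`. -/
def uncoveredProd (f : Fin n → R) (S : Finset (Fin n)) : R := (List.ofFn (uncoveredFactor f S)).prod

theorem uncoveredFactor_empty (f : Fin n → R) : uncoveredFactor f ∅ = f := by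
  ext j
  simp [uncoveredFactor]

theorem uncoveredFactor_insert (f : Fin n → R) (i : Fin n) (S : Finset (Fin n)) :
    uncoveredFactor f (insert i S) =
      Function.update (Function.update (uncoveredFactor f S) (i + 1) 1) i 1 := by
  ext j
  simp only [uncoveredFactor, Function.update_apply, Finset.mem_insert, sub_eq_iff_eq_add]
  grind

theorem commute_uncoveredFactor {u : R} {f : Fin n → R} {j : Fin n} (h : Commute u (f j))
    (S : Finset (Fin n)) : Commute u (uncoveredFactor f S j) := by
  rw [uncoveredFactor]
  split_ifs
  exacts [Commute.one_right u, h]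

/-- The families `X` and `Y` behave like `X i` and `t i • (X i)⁻¹ * g i` in the quantum torus: the
only pairs that need not commute are `X i, Y i` and `X (i + 1), Y i`. -/
structure CyclicallyCommuting (X Y : Fin n → R) : Prop where
  X_X : ∀ i j, Commute (X i) (X j)
  Y_Y : ∀ i j, Commute (Y i) (Y j)
  Y_X : ∀ i j, j ≠ i → j ≠ i + 1 → Commute (Y i) (X j)

variable {x s X Y : Fin n → R}

theorem binomialChoice_empty (X Y : Fin n → R) :
    binomialChoice X Y ∅ = fun j => -Y (j - 1) := Finset.piecewise_empty _ _

theorem binomialChoice_univ (X Y : Fin n → R) : binomialChoice X Y Finset.univ = X :=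
  Finset.piecewise_univ _ _

theorem binomialChoice_of_mem {D : Finset (Fin n)} {i : Fin n} (hi : i ∈ D) :
    binomialChoice X Y D i = X i := Finset.piecewise_eq_of_mem _ _ _ hi

theorem binomialChoice_of_notMem {D : Finset (Fin n)} {i : Fin n} (hi : i ∉ D) :
    binomialChoice X Y D i = -Y (i - 1) := Finset.piecewise_eq_of_notMem _ _ _ hi

theorem CyclicallyCommuting.prod_binomialChoice_empty (h : CyclicallyCommuting X Y) :
    (List.ofFn (binomialChoice X Y ∅)).prod = (-1) ^ n * (List.ofFn Y).prod := by
  rw [binomialChoice_empty]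
  have hrotate : (List.ofFn fun j => Y (j - 1)).prod = (List.ofFn Y).prod :=
    (Equiv.Perm.ofFn_comp_perm (Equiv.subRight (1 : Fin n)) Y).prod_eq'
      (List.pairwise_ofFn.2 fun _ _ _ => h.Y_Y _ _)
  have hneg := List.prod_map_neg (List.ofFn fun j => Y (j - 1))
  rwa [List.map_ofFn, List.length_ofFn, hrotate] at hneg

theorem CyclicallyCommuting.X_binomialChoice (h : CyclicallyCommuting X Y) (D : Finset (Fin n))
    {i j : Fin n} (hi : j ≠ i) (hi' : j ≠ i + 1) : Commute (X i) (binomialChoice X Y D j) := by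
  by_cases hj : j ∈ D
  · rw [binomialChoice_of_mem hj]
    exact h.X_X i j
  · rw [binomialChoice_of_notMem hj]
    refine (h.Y_X _ _ (fun hij => hi' ?_) (fun hij => hi ?_)).symm.neg_right
    · rw [hij, sub_add_cancel]
    · rw [hij, sub_add_cancel]

theorem CyclicallyCommuting.Y_binomialChoice (h : CyclicallyCommuting X Y) (D : Finset (Fin n))
    {i j : Fin n} (hi : j ≠ i) (hi' : j ≠ i + 1) : Commute (Y i) (binomialChoice X Y D j) := by
  by_cases hj : j ∈ D
  · rw [binomialChoice_of_mem hj]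
    exact h.Y_X i j hi hi'
  · rw [binomialChoice_of_notMem hj]
    exact (h.Y_Y _ _).neg_right

theorem CyclicallyCommuting.uncoveredProd_insert (h : CyclicallyCommuting X Y)
    (hs : ∀ i : Fin n, s i = if i.val + 1 = n then Y i * X i else X i * Y i)
    {D S : Finset (Fin n)} {i : Fin n} (hi : i ∈ runEnds D) (hS : S ⊆ runEnds D) (hiS : i ∉ S) :
    uncoveredProd (binomialChoice X Y D) (insert i S) * s i =
      -uncoveredProd (binomialChoice X Y D) S := by
  obtain ⟨hiD, hiD'⟩ := Finset.mem_filter.1 hi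
  have hcover : ∀ j ∈ S, j ∈ D ∧ j + 1 ∉ D := fun j hj => Finset.mem_filter.1 (hS hj)
  set f := uncoveredFactor (binomialChoice X Y D) S with hf
  have hfi : f i = X i := by
    have : i - 1 ∉ S := fun hmem => (hcover _ hmem).2 (by rwa [sub_add_cancel])
    rw [hf, uncoveredFactor, if_neg (by simp [hiS, this]), binomialChoice_of_mem hiD]
  have hfi' : f (i + 1) = -Y i := by
    have : i + 1 ∉ S := fun hmem => hiD' (hcover _ hmem).1
    rw [hf, uncoveredFactor, if_neg (by simp [hiS, this]), binomialChoice_of_notMem hiD',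
      add_sub_cancel_right]
  have hXf : ∀ j, j ≠ i → j ≠ i + 1 → Commute (f i) (f j) := fun j hj hj' =>
    hfi ▸ commute_uncoveredFactor (h.X_binomialChoice D hj hj') S
  have hYf : ∀ j, j ≠ i → j ≠ i + 1 → Commute (f (i + 1)) (f j) := fun j hj hj' =>
    hfi' ▸ (commute_uncoveredFactor (h.Y_binomialChoice D hj hj') S).neg_left
  have hne : i ≠ i + 1 := fun heq => hiD' (heq ▸ hiD)
  have hneval := Fin.val_ne_iff.2 hne
  have hval := val_add_one i
  rw [hs, ← neg_eq_iff_eq_neg, ← mul_neg, uncoveredProd, uncoveredProd, uncoveredFactor_insert]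
  split_ifs at hval ⊢ with hlast
  · rw [Function.update_comm hne.symm, ← neg_mul, ← hfi, ← hfi']
    refine (prod_ofFn_eq_prod_update_update_mul (by rw [Fin.lt_def]; lia)
      (fun j hj hj' => hYf j hj' hj.ne') fun j hj => absurd j.isLt ?_).symm
    rw [Fin.lt_def] at hj
    lia
  · rw [← mul_neg, ← hfi, ← hfi']
    refine (prod_ofFn_eq_prod_update_update_mul (by rw [Fin.lt_def]; lia)
      (fun j hj hj' => hXf j hj.ne' hj') fun j hj => hYf j ?_ hj.ne').symm
    rw [Fin.lt_def] at hj
    exact Fin.val_ne_iff.1 (by lia)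

theorem CyclicallyCommuting.uncoveredProd_mul_prod_sort (h : CyclicallyCommuting X Y)
    (hs : ∀ i : Fin n, s i = if i.val + 1 = n then Y i * X i else X i * Y i)
    {D S : Finset (Fin n)} (hS : S ⊆ runEnds D) :
    uncoveredProd (binomialChoice X Y D) S * (S.sort.map s).prod =
      (-1) ^ S.card * (List.ofFn (binomialChoice X Y D)).prod := by
  induction S using Finset.induction_on_min with
  | empty => simp [uncoveredProd, uncoveredFactor_empty]
  | insert i S hmin ih =>
    have hiS : i ∉ S := fun hi => (hmin i hi).false
    obtain ⟨hi, hS⟩ := Finset.insert_subset_iff.1 hS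
    rw [Finset.sort_insert _ (fun j hj => (hmin j hj).le) hiS, List.map_cons, List.prod_cons,
      ← mul_assoc, h.uncoveredProd_insert hs hi hS hiS, neg_mul, ih hS,
      Finset.card_insert_of_notMem hiS, pow_succ, mul_neg_one, neg_mul]

theorem uncoveredProd_eq_sum (hn : 3 ≤ n) (hx : ∀ j, x j = X j - Y (j - 1)) {S : Finset (Fin n)}
    (hS : S ∈ indexJ n) :
    uncoveredProd x S =
      ∑ D, if S ⊆ runEnds D then uncoveredProd (binomialChoice X Y D) S else 0 := by
  set first : Fin n → R := fun j => if j ∈ S then 1 else if j - 1 ∈ S then 0 else X j with hfirst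
  set second : Fin n → R := fun j => if j ∈ S then 0 else if j - 1 ∈ S then 1 else -Y (j - 1)
    with hsecond
  have hsplit : uncoveredFactor x S = first + second := by
    ext j
    simp only [uncoveredFactor, hfirst, hsecond, Pi.add_apply, hx]
    split_ifs <;> grind
  have hexpand := (MultilinearMap.mkPiAlgebraFin ℤ n R).map_add_univ first second
  simp only [MultilinearMap.mkPiAlgebraFin_apply] at hexpand
  rw [uncoveredProd, hsplit, hexpand]
  refine Finset.sum_congr rfl fun D _ => ?_
  split_ifs with hSD
  · have hcover : ∀ j ∈ S, j ∈ D ∧ j + 1 ∉ D := fun j hj => Finset.mem_filter.1 (hSD hj)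
    rw [uncoveredProd]
    congr 2
    ext j
    have hj := hcover j
    have hj' := hcover (j - 1)
    rw [sub_add_cancel] at hj'
    simp only [uncoveredFactor, binomialChoice, Finset.piecewise, hfirst, hsecond]
    split_ifs <;> grind
  · obtain ⟨i, hi, hiD⟩ := Finset.not_subset.1 hSD
    have hi' : i + 1 ∉ S := (mem_indexJ hn S).1 hS i hi
    refine List.prod_eq_zero ((List.mem_ofFn' _ _).2 ?_)
    by_cases hmem : i ∈ D
    · refine ⟨i + 1, ?_⟩
      have : i + 1 ∈ D := by simpa [runEnds, hmem] using hiD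
      simp [this, hfirst, hi, hi']
    · exact ⟨i, by simp [hmem, hsecond, hi]⟩

theorem CyclicallyCommuting.sum_indexJ (hn : 3 ≤ n) (h : CyclicallyCommuting X Y)
    (hx : ∀ j, x j = X j - Y (j - 1))
    (hs : ∀ i : Fin n, s i = if i.val + 1 = n then Y i * X i else X i * Y i) :
    ∑ S ∈ indexJ n, (List.ofFn fun j => x j ^ (deltaSub S j).toNat).prod * (S.sort.map s).prod =
      (List.ofFn X).prod + (-1) ^ n * (List.ofFn Y).prod := by
  calc
    _ = ∑ S ∈ indexJ n, ∑ D, if S ⊆ runEnds D then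
          (-1) ^ S.card * (List.ofFn (binomialChoice X Y D)).prod else 0 := by
      refine Finset.sum_congr rfl fun S hS => ?_
      have : (List.ofFn fun j => x j ^ (deltaSub S j).toNat).prod = uncoveredProd x S := by
        simp only [deltaSub_toNat, pow_ite, pow_zero, pow_one]
        rfl
      rw [this, uncoveredProd_eq_sum hn hx hS, Finset.sum_mul]
      refine Finset.sum_congr rfl fun D _ => ?_
      rw [ite_mul, zero_mul]
      exact ite_congr rfl (h.uncoveredProd_mul_prod_sort hs) fun _ => rfl
    _ = ∑ D, (∑ S ∈ (runEnds D).powerset, (-1) ^ S.card) *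
          (List.ofFn (binomialChoice X Y D)).prod := by
      rw [Finset.sum_comm]
      refine Finset.sum_congr rfl fun D _ => ?_
      rw [← Finset.sum_filter, Finset.sum_mul]
      refine Finset.sum_congr (Finset.ext fun S => ?_) fun _ _ => rfl
      rw [Finset.mem_filter, Finset.mem_powerset, and_iff_right_iff_imp]
      exact mem_indexJ_of_subset_runEnds hn
    _ = ∑ D, if D = ∅ ∨ D = Finset.univ then (List.ofFn (binomialChoice X Y D)).prod else 0 := by
      refine Finset.sum_congr rfl fun D _ => ?_
      have hsum := congrArg (Int.cast (R := R))
        (Finset.sum_powerset_neg_one_pow_card (x := runEnds D))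
      push_cast at hsum
      simp only [hsum, ite_mul, one_mul, zero_mul, runEnds_eq_empty_iff]
    _ = _ := by
      rw [← Finset.sum_filter, Finset.filter_or, Finset.filter_eq', Finset.filter_eq',
        if_pos (Finset.mem_univ _), if_pos (Finset.mem_univ _), ← Finset.insert_eq, Finset.sum_pair,
        h.prod_binomialChoice_empty, binomialChoice_univ, add_comm]
      exact Finset.univ_nonempty.ne_empty.symm

end CyclicContinuant

section QuantumTorus

variable {ℓ : ℕ}

/-- The `j`-th diagonal entry as a homomorphism to the units of `ℂ`. -/
def entryUnit (j : Fin n) : diagGroup n ℓ →* ℂˣ :=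
  MonoidHom.toHomUnits
    { toFun := fun g => entry g j
      map_one' := entry_one j
      map_mul' := fun g h => entry_mul g h j }

theorem coe_entryUnit (j : Fin n) (g : diagGroup n ℓ) : (entryUnit j g : ℂ) = entry g j := rfl

/-- The eigenvalue of `g` on the Laurent monomial with exponent `p`. -/
def weight (p : Fin n → ℤ) : diagGroup n ℓ →* ℂˣ := ∏ j, (entryUnit j) ^ p j

theorem weight_apply (p : Fin n → ℤ) (g : diagGroup n ℓ) :
    weight p g = ∏ j, entryUnit j g ^ p j := by
  simp [weight]

theorem weight_add (p q : Fin n → ℤ) (g : diagGroup n ℓ) :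
    weight (p + q) g = weight p g * weight q g := by
  simp [weight_apply, zpow_add, Finset.prod_mul_distrib]

theorem weight_zero (g : diagGroup n ℓ) : weight 0 g = 1 := by
  simp [weight_apply]

theorem weight_neg (p : Fin n → ℤ) (g : diagGroup n ℓ) : weight (-p) g = (weight p g)⁻¹ := by
  simp [weight_apply]

theorem weight_single (j : Fin n) (g : diagGroup n ℓ) (c : ℤ) :
    weight (Pi.single j c) g = entryUnit j g ^ c := by
  rw [weight_apply, Finset.prod_eq_single j]
  · simp
  · intro i _ hij
    simp [hij]
  · simp

theorem weight_nsmul (m : ℕ) (p : Fin n → ℤ) (g : diagGroup n ℓ) :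
    weight (m • p) g = weight p g ^ m := by
  induction m with
  | zero => simp [weight_zero]
  | succ m ih => rw [succ_nsmul, weight_add, ih, pow_succ]

theorem weight_one (g : diagGroup n ℓ) : weight 1 g = 1 := by
  have hdet : ∏ j, entry g j = 1 := by
    rw [← Matrix.det_diagonal, ← coe_eq_diagonal, Matrix.SpecialLinearGroup.det_coe]
  apply Units.ext
  simpa [weight_apply, Units.coe_prod, coe_entryUnit] using hdet

/-- The product of the lattice of exponents of Laurent monomials with `G`. -/
abbrev TorusGroup (n ℓ : ℕ) : Type := Multiplicative (Fin n → ℤ) × diagGroup n ℓ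

variable [NeZero ℓ] {ζ : ℂ} (hζ : IsPrimitiveRoot ζ ℓ)

theorem cocycleFun_one_left (g : diagGroup n ℓ) :
    cocycleFun hζ 1 g = 1 := (cocycle n hζ).map_one_left g

theorem cocycleFun_one_right (g : diagGroup n ℓ) :
    cocycleFun hζ g 1 = 1 := (cocycle n hζ).map_one_right g

/-- The scalar in the product of a Laurent monomial times `g` with the Laurent monomial of
exponent `q` times `h`. -/
def twist (q : Fin n → ℤ) (h : diagGroup n ℓ) :
    diagGroup n ℓ →* ℂˣ where
  toFun g := cocycleFun hζ g h * weight q g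
  map_one' := by rw [cocycleFun_one_left, map_one, one_mul]
  map_mul' g g' := by rw [cocycleFun_mul_left, map_mul, mul_mul_mul_comm]

theorem twist_apply (q : Fin n → ℤ) (g h : diagGroup n ℓ) :
    twist hζ q h g = cocycleFun hζ g h * weight q g := rfl

theorem twist_add_mul (q q' : Fin n → ℤ) (g h h' : diagGroup n ℓ) :
    twist hζ (q + q') (h * h') g = twist hζ q h g * twist hζ q' h' g := by
  rw [twist_apply, twist_apply, twist_apply, weight_add, cocycleFun_mul_right, mul_mul_mul_comm]

theorem twist_one (q : Fin n → ℤ) (g : diagGroup n ℓ) :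
    twist hζ q 1 g = weight q g := by
  rw [twist_apply, cocycleFun_one_right, one_mul]

theorem twist_zero (g h : diagGroup n ℓ) :
    twist hζ 0 h g = cocycleFun hζ g h := by
  rw [twist_apply, weight_zero, mul_one]

/-- The cocycle of the quantum torus. -/
def torusCocycle (n : ℕ) (hζ : IsPrimitiveRoot ζ ℓ) : NormalizedCocycle ℂ (TorusGroup n ℓ) where
  toFun u v := twist hζ v.1.toAdd v.2 u.2
  map_one_left _ := map_one _
  map_one_right u := by
    change twist hζ 0 1 u.2 = 1
    rw [twist_one, weight_zero]
  cocycle u v w := by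
    change twist hζ v.1.toAdd v.2 u.2 * twist hζ w.1.toAdd w.2 (u.2 * v.2) =
      twist hζ w.1.toAdd w.2 v.2 * twist hζ (v.1.toAdd + w.1.toAdd) (v.2 * w.2) u.2
    rw [twist_add_mul, map_mul, ← mul_assoc, mul_comm]

/-- The quantum torus spanned by the products of Laurent monomials and elements of `G`. -/
abbrev Torus (n : ℕ) (hζ : IsPrimitiveRoot ζ ℓ) : Type :=
  CrossedProduct (1 : TorusGroup n ℓ →* (ℂ ≃ₐ[ℂ] ℂ)) (torusCocycle n hζ)

/-- The Laurent monomial with exponent `p` times `g`. -/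
def mon (p : Fin n → ℤ) (g : diagGroup n ℓ) : Torus n hζ :=
  CrossedProduct.single (Multiplicative.ofAdd p, g) 1

/-- The coefficient at the Laurent monomial with exponent `p` times `g`. -/
def coefAt (p : Fin n → ℤ) (g : diagGroup n ℓ) : Torus n hζ →ₗ[ℂ] ℂ :=
  (Finsupp.lapply (Multiplicative.ofAdd p, g)).comp CrossedProduct.coeffLinear

open Classical in
theorem coefAt_mon (p q : Fin n → ℤ) (g h : diagGroup n ℓ) :
    coefAt hζ p g (mon hζ q h) = if p = q ∧ g = h then 1 else 0 := by
  change (Finsupp.single (Multiplicative.ofAdd q, h) (1 : ℂ)) (Multiplicative.ofAdd p, g) = _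
  rw [Finsupp.single_apply]
  refine if_congr ?_ rfl rfl
  rw [Prod.mk.injEq]
  exact ⟨fun h => ⟨h.1.symm, h.2.symm⟩, fun h => ⟨congrArg _ h.1.symm, h.2.symm⟩⟩

@[elab_as_elim]
theorem torus_induction {hζ : IsPrimitiveRoot ζ ℓ} {P : Torus n hζ → Prop} (a : Torus n hζ)
    (h0 : P 0) (hadd : ∀ a b, P a → P b → P (a + b))
    (hm : ∀ (c : ℂ) p g, P (c • mon hζ p g)) : P a := by
  induction a using CrossedProduct.induction_on with
  | h0 => exact h0
  | hadd a b ha hb => exact hadd a b ha hb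
  | hs u r =>
    have := hm r u.1.toAdd u.2
    rw [mon, CrossedProduct.smul_single, smul_eq_mul, mul_one] at this
    exact this

theorem mon_mul_mon (p q : Fin n → ℤ) (g h : diagGroup n ℓ) :
    mon hζ p g * mon hζ q h = (twist hζ q h g : ℂ) • mon hζ (p + q) (g * h) := by
  rw [mon, mon, CrossedProduct.single_mul_single, mon, CrossedProduct.smul_single]
  rw [map_one, mul_one, Units.smul_def]
  rfl

theorem mon_one_mul_mon (p q : Fin n → ℤ) (h : diagGroup n ℓ) :
    mon hζ p 1 * mon hζ q h = mon hζ (p + q) h := by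
  rw [mon_mul_mon, map_one, Units.val_one, one_smul, one_mul]

theorem mon_mul_mon_one (p q : Fin n → ℤ) (g : diagGroup n ℓ) :
    mon hζ p g * mon hζ q 1 = (weight q g : ℂ) • mon hζ (p + q) g := by
  rw [mon_mul_mon, twist_one, mul_one]

theorem mon_zero_one : mon hζ (0 : Fin n → ℤ) 1 = 1 := rfl

theorem mon_pow (p : Fin n → ℤ) (g : diagGroup n ℓ) (k : ℕ) :
    mon hζ p g ^ k = ((twist hζ p g g : ℂ) ^ (k.choose 2)) • mon hζ (k • p) (g ^ k) := by
  induction k with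
  | zero => simp [mon_zero_one]
  | succ k ih =>
    rw [pow_succ, ih, smul_mul_assoc, mon_mul_mon, smul_smul, map_pow, Units.val_pow_eq_pow_val,
      ← pow_add, succ_nsmul, pow_succ]
    congr 2
    rw [Nat.choose_succ_succ' k 1, Nat.choose_one_right, add_comm]

theorem mon_one_pow (p : Fin n → ℤ) (k : ℕ) :
    mon hζ p (1 : diagGroup n ℓ) ^ k = mon hζ (k • p) 1 := by
  rw [mon_pow, map_one, Units.val_one, one_pow, one_smul, one_pow]

theorem mem_center_of_weight {p : Fin n → ℤ}
    (h : ∀ g : diagGroup n ℓ, weight p g = 1) :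
    mon hζ p 1 ∈ Subalgebra.center ℂ (Torus n hζ) := by
  rw [Subalgebra.mem_center_iff]
  intro b
  induction b using torus_induction with
  | h0 => simp
  | hadd a b ha hb => rw [add_mul, mul_add, ha, hb]
  | hm c q g =>
    rw [smul_mul_assoc, mul_smul_comm, mon_mul_mon_one, mon_one_mul_mon, h, Units.val_one,
      one_smul, add_comm]

end QuantumTorus

section TorusGenerators

variable {ℓ : ℕ} [NeZero ℓ] {ζ : ℂ} (hζ : IsPrimitiveRoot ζ ℓ)

/-- The variable `x_i` of the quantum torus. -/
def torusX (i : Fin n) : Torus n hζ := mon hζ (Pi.single i 1) 1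

theorem mon_mul_torusX (p : Fin n → ℤ) (g : diagGroup n ℓ) (j : Fin n) :
    mon hζ p g * torusX hζ j = entry g j • (torusX hζ j * mon hζ p g) := by
  rw [torusX, mon_mul_mon_one, mon_one_mul_mon, weight_single, zpow_one, coe_entryUnit, add_comm]

theorem twist_sum_prod {ι : Type*} (s : Finset ι) (q : ι → Fin n → ℤ) (h : ι → diagGroup n ℓ)
    (g : diagGroup n ℓ) :
    twist hζ (∑ j ∈ s, q j) (∏ j ∈ s, h j) g = ∏ j ∈ s, twist hζ (q j) (h j) g := by
  classical
  induction s using Finset.induction_on with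
  | empty => rw [Finset.sum_empty, Finset.prod_empty, Finset.prod_empty, twist_one, weight_zero]
  | insert j s hj ih =>
    rw [Finset.sum_insert hj, Finset.prod_insert hj, Finset.prod_insert hj, twist_add_mul, ih]

variable [NeZero n]

theorem entryUnit_gen (i j : Fin n) :
    entryUnit j (gen hζ i) =
      zetaUnit hζ ^ ((if j = i then 1 else 0) - (if j = i + 1 then 1 else 0) : ℤ) := by
  apply Units.ext
  rw [coe_entryUnit, entry_gen, zpow_sub, Units.val_mul]
  split_ifs <;> simp [coe_zetaUnit]

theorem prod_gen : ∏ i : Fin n, gen hζ i = 1 := by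
  refine ext_entry fun j => ?_
  rw [entry_one, ← coe_entryUnit, map_prod, Units.coe_prod]
  simp only [coe_entryUnit, entry_gen, Finset.prod_mul_distrib, Finset.prod_ite_eq,
    ← sub_eq_iff_eq_add, Finset.mem_univ, if_true]
  exact mul_inv_cancel₀ (hζ.ne_zero (NeZero.ne ℓ))

theorem monoidHom_ext_gen {M : Type*} [CommMonoid M] {f f' : diagGroup n ℓ →* M}
    (h : ∀ i, f (gen hζ i) = f' (gen hζ i)) : f = f' := by
  ext g
  rw [← prod_gen_pow_exponent hζ g, map_prod, map_prod]
  exact Finset.prod_congr rfl fun k _ => by rw [map_pow, map_pow, h]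

theorem cocycleFun_gen {i j : Fin n} (hi : i.val + 1 ≠ n) (hj : j.val + 1 ≠ n) :
    cocycleFun hζ (gen hζ i) (gen hζ j) = zetaUnit hζ ^ (-if j = i + 1 then 1 else 0 : ℤ) := by
  have hgen : ∀ k : Fin n, k.val + 1 ≠ n → gen hζ k =
      ∏ m ∈ Finset.range (n - 1), gen hζ (Fin.ofNat n m) ^ (Pi.single k.val 1 : ℕ → ℤ) m :=
    fun k hk => by
      rw [Finset.prod_eq_single k.val (fun m _ hm => by simp [hm])
        (fun hmem => absurd (Finset.mem_range.2 (by lia)) hmem), Pi.single_eq_same, zpow_one,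
        Fin.ofNat_val_eq_self]
  have hval := val_add_one i
  rw [if_neg hi] at hval
  rw [hgen i hi, hgen j hj, cocycleFun_prod_gen]
  simp only [Fin.ext_iff, hval]
  congr 2
  rw [Finset.sum_eq_single i.val]
  · simp [Pi.single_apply, eq_comm]
  · intro m _ hm
    simp [hm]
  · intro hmem
    refine mul_eq_zero_of_right _ (Pi.single_eq_of_ne ?_ _)
    rw [Finset.mem_range] at hmem
    lia

theorem prod_twist_gen_left (q : Fin n → ℤ) (g : diagGroup n ℓ) :
    ∏ i, twist hζ q g (gen hζ i) = 1 := by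
  rw [← map_prod, prod_gen, map_one]

theorem prod_twist_gen_right (g : diagGroup n ℓ) :
    ∏ j, twist hζ (-Pi.single j 1) (gen hζ j) g = 1 := by
  rw [← twist_sum_prod, prod_gen, twist_one, Finset.sum_neg_distrib, weight_neg,
    show ∑ j : Fin n, Pi.single j (1 : ℤ) = 1 from Finset.univ_sum_single 1, weight_one, inv_one]

theorem twist_gen_of_ne_last {i j : Fin n} (hi : i.val + 1 ≠ n) (hj : j.val + 1 ≠ n) :
    twist hζ (-Pi.single j 1) (gen hζ j) (gen hζ i) =
      zetaUnit hζ ^ (if j = i then -1 else 0 : ℤ) := by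
  rw [twist_apply, weight_neg, weight_single, zpow_one, entryUnit_gen, cocycleFun_gen hζ hi hj,
    ← zpow_neg, ← zpow_add]
  congr 1
  split_ifs <;> rfl

theorem twist_gen_last_left {i j : Fin n} (hi : i.val + 1 = n) (hj : j.val + 1 ≠ n) :
    twist hζ (-Pi.single j 1) (gen hζ j) (gen hζ i) = zetaUnit hζ := by
  have hprod := prod_twist_gen_left hζ (-Pi.single j 1) (gen hζ j)
  rw [← Finset.mul_prod_erase _ _ (Finset.mem_univ i), Finset.prod_eq_single j,
    twist_gen_of_ne_last hζ hj hj, if_pos rfl, zpow_neg_one, mul_inv_eq_one] at hprod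
  · exact hprod
  · intro m hm hmj
    rw [twist_gen_of_ne_last hζ (by grind) hj, if_neg hmj.symm, zpow_zero]
  · grind

theorem twist_gen_last_right {i j : Fin n} (hi : i.val + 1 ≠ n) (hj : j.val + 1 = n) :
    twist hζ (-Pi.single j 1) (gen hζ j) (gen hζ i) = zetaUnit hζ := by
  have hprod := prod_twist_gen_right hζ (gen hζ i)
  rw [← Finset.mul_prod_erase _ _ (Finset.mem_univ j), Finset.prod_eq_single i,
    twist_gen_of_ne_last hζ hi hi, if_pos rfl, zpow_neg_one, mul_inv_eq_one] at hprod
  · exact hprod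
  · intro m hm hmi
    rw [twist_gen_of_ne_last hζ hi (by grind), if_neg hmi, zpow_zero]
  · grind

theorem twist_gen_last {i : Fin n} (hi : i.val + 1 = n) :
    twist hζ (-Pi.single i 1) (gen hζ i) (gen hζ i) = (zetaUnit hζ ^ (n - 1))⁻¹ := by
  have hprod := prod_twist_gen_right hζ (gen hζ i)
  rwa [← Finset.mul_prod_erase _ _ (Finset.mem_univ i), Finset.prod_congr rfl fun m hm =>
      twist_gen_last_left hζ hi (j := m) (by grind), Finset.prod_const,
    Finset.card_erase_of_mem (Finset.mem_univ i), Finset.card_univ, Fintype.card_fin,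
    mul_eq_one_iff_eq_inv] at hprod

theorem twist_gen_comm (i j : Fin n) :
    twist hζ (-Pi.single j 1) (gen hζ j) (gen hζ i) =
      twist hζ (-Pi.single i 1) (gen hζ i) (gen hζ j) := by
  by_cases hi : i.val + 1 = n <;> by_cases hj : j.val + 1 = n
  · rw [show i = j by lia]
  · rw [twist_gen_last_left hζ hi hj, twist_gen_last_right hζ hj hi]
  · rw [twist_gen_last_right hζ hi hj, twist_gen_last_left hζ hj hi]
  · rw [twist_gen_of_ne_last hζ hi hj, twist_gen_of_ne_last hζ hj hi]
    simp only [eq_comm]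

theorem twist_gen_eq (k : Fin n) (g : diagGroup n ℓ) :
    twist hζ (-Pi.single k 1) (gen hζ k) g = cocycleFun hζ (gen hζ k) g * entryUnit (k + 1) g := by
  let cocycleLeft : diagGroup n ℓ →* ℂˣ :=
    { toFun := cocycleFun hζ (gen hζ k)
      map_one' := cocycleFun_one_right hζ _
      map_mul' := cocycleFun_mul_right hζ _ }
  have hext : twist hζ (-Pi.single k 1) (gen hζ k) = cocycleLeft * entryUnit (k + 1) := by
    refine monoidHom_ext_gen hζ fun i => ?_
    rw [twist_gen_comm, twist_apply, MonoidHom.mul_apply, weight_neg, weight_single, zpow_one,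
      entryUnit_gen, entryUnit_gen, ← zpow_neg]
    congr 2
    simp only [add_left_inj, eq_comm (a := i), neg_sub]
  rw [hext]
  rfl

variable (t : Fin n → ℂ)

/-- The element `t_i / (ζ - 1) x_i⁻¹ g_i` of the quantum torus. -/
def torusY (i : Fin n) : Torus n hζ := (t i / (ζ - 1)) • mon hζ (-Pi.single i 1) (gen hζ i)

theorem torusY_mul_torusX (i j : Fin n) :
    torusY hζ t i * torusX hζ j = entry (gen hζ i) j • (torusX hζ j * torusY hζ t i) := by
  rw [torusY, smul_mul_assoc, mon_mul_torusX, mul_smul_comm, smul_comm]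

theorem cyclicallyCommuting_torusX_torusY :
    CyclicallyCommuting (torusX hζ) (torusY hζ t) where
  X_X i j := by
    rw [Commute, SemiconjBy, torusX, torusX, mon_one_mul_mon, mon_one_mul_mon, add_comm]
  Y_Y i j := by
    refine Commute.smul_left (Commute.smul_right ?_ _) _
    rw [Commute, SemiconjBy, mon_mul_mon, mon_mul_mon, twist_gen_comm, add_comm, mul_comm]
  Y_X i j hji hji' := by
    rw [Commute, SemiconjBy, torusY_mul_torusX, entry_gen, if_neg hji, if_neg hji', one_mul,
      one_smul]

theorem torusX_mul_torusY (i : Fin n) :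
    torusX hζ i * torusY hζ t i = (t i / (ζ - 1)) • mon hζ 0 (gen hζ i) := by
  rw [torusY, mul_smul_comm, torusX, mon_one_mul_mon, add_neg_cancel]

/-- The image of the generator `x_i` of the Hecke algebra in the quantum torus. -/
def torusGen (i : Fin n) : Torus n hζ := torusX hζ i - torusY hζ t (i - 1)

theorem torusGen_commutator (i j : Fin n) :
    torusGen hζ t i * torusGen hζ t j - torusGen hζ t j * torusGen hζ t i =
      (entry (gen hζ (j - 1)) i - 1) • (torusX hζ i * torusY hζ t (j - 1)) -
      (entry (gen hζ (i - 1)) j - 1) • (torusX hζ j * torusY hζ t (i - 1)) := by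
  have hX := ((cyclicallyCommuting_torusX_torusY hζ t).X_X i j).eq
  have hY := ((cyclicallyCommuting_torusX_torusY hζ t).Y_Y (i - 1) (j - 1)).eq
  simp only [torusGen, mul_sub, sub_mul, torusY_mul_torusX, sub_smul, one_smul, hX, hY]
  abel

theorem torusGen_adjacent (hn : 3 ≤ n) (hζ1 : ζ ≠ 1) (i : Fin n) :
    torusGen hζ t i * torusGen hζ t (i + 1) - torusGen hζ t (i + 1) * torusGen hζ t i =
      t i • mon hζ 0 (gen hζ i) := by
  have hne : i + 1 ≠ i - 1 := by
    rw [Ne, eq_sub_iff_add_eq, Fin.ext_iff, val_add_one, val_add_one]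
    split_ifs <;> lia
  have hne' : i + 1 ≠ i := by
    rw [Ne, Fin.ext_iff, val_add_one]
    split_ifs <;> lia
  rw [torusGen_commutator, add_sub_cancel_right, torusX_mul_torusY, entry_gen, entry_gen,
    if_pos rfl, if_neg hne'.symm, if_neg hne, sub_add_cancel, if_neg hne', mul_one, mul_one,
    sub_self, zero_smul, sub_zero, smul_smul, mul_div_cancel₀ _ (sub_ne_zero.2 hζ1)]

theorem torusGen_nonAdjacent (hn : 3 ≤ n) {i j : Fin n} (h : NonAdjacent i j) :
    torusGen hζ t i * torusGen hζ t j - torusGen hζ t j * torusGen hζ t i = 0 := by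
  rcases eq_or_ne i j with rfl | hij
  · exact sub_self _
  · obtain ⟨hne, hne'⟩ := (nonAdjacent_iff hn i j).1 h
    rw [torusGen_commutator, entry_gen, entry_gen, sub_add_cancel, sub_add_cancel,
      if_neg hij, if_neg hij.symm, if_neg fun h => hne' (eq_sub_iff_add_eq.1 h),
      if_neg fun h => hne (eq_sub_iff_add_eq.1 h), mul_one, sub_self, zero_smul, zero_smul,
      sub_zero]

theorem mon_mul_torusGen (g : diagGroup n ℓ) (j : Fin n) :
    mon hζ 0 g * torusGen hζ t j = entry g j • (torusGen hζ t j * mon hζ 0 g) := by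
  rw [torusGen, mul_sub, sub_mul, smul_sub, mon_mul_torusX, torusY, mul_smul_comm, smul_mul_assoc,
    smul_comm (entry g j), mon_mul_mon, mon_mul_mon, twist_zero, twist_gen_eq, sub_add_cancel,
    smul_smul (entry g j), Units.val_mul, coe_entryUnit, mul_comm (entry g j), zero_add, add_zero,
    mul_comm g]

end TorusGenerators

section Powers

theorem prod_one_sub_pow_mul_X {k : Type*} [CommRing k] [IsDomain k] {ℓ : ℕ} [NeZero ℓ] {ζ : k}
    (hζ : IsPrimitiveRoot ζ ℓ) :
    ∏ i ∈ Finset.range ℓ, (1 - Polynomial.C (ζ ^ i) * Polynomial.X) = 1 - Polynomial.X ^ ℓ := by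
  have hroots := X_pow_sub_C_eq_prod (hζ.map_of_injective Polynomial.C_injective)
    (Nat.pos_of_neZero ℓ) (rfl : (Polynomial.X : Polynomial k) ^ ℓ = _)
  simpa [Polynomial.eval_prod] using (congrArg (Polynomial.eval 1) hroots).symm

theorem pow_mul_one_sub {k A : Type*} [CommRing k] [IsDomain k] [Ring A] [Algebra k A] {ℓ : ℕ}
    [NeZero ℓ] {ζ : k} (hζ : IsPrimitiveRoot ζ ℓ) {x T : A} (h : T * x = ζ • (x * T)) :
    (x * (1 - T)) ^ ℓ = x ^ ℓ * (1 - T ^ ℓ) := by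
  have hpow (m : ℕ) : T * x ^ m = ζ ^ m • (x ^ m * T) := by
    induction m with
    | zero => simp
    | succ m ih =>
      rw [pow_succ, ← mul_assoc, ih, smul_mul_assoc, mul_assoc, h, mul_smul_comm, smul_smul,
        mul_assoc, pow_succ]
  have hprod (m : ℕ) : (x * (1 - T)) ^ m = x ^ m * Polynomial.aeval T
      (∏ i ∈ Finset.range m, (1 - Polynomial.C (ζ ^ i) * Polynomial.X)) := by
    induction m with
    | zero => simp
    | succ m ih =>
      have hmove : (1 - T) * x ^ m = x ^ m * (1 - ζ ^ m • T) := by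
        rw [sub_mul, one_mul, hpow, mul_sub, mul_one, mul_smul_comm]
      rw [pow_succ', ih, mul_assoc, ← mul_assoc (1 - T), hmove, mul_assoc, ← mul_assoc, ← pow_succ',
        Finset.prod_range_succ, mul_comm (Finset.prod _ _), map_mul, map_sub, map_mul, map_one,
        Polynomial.aeval_C, Polynomial.aeval_X, Algebra.smul_def]
  rw [hprod, prod_one_sub_pow_mul_X hζ, map_sub, map_one, map_pow, Polynomial.aeval_X]

theorem pow_choose_two_of_isPrimitiveRoot {k : Type*} [CommRing k] [IsDomain k] {ℓ : ℕ} [NeZero ℓ]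
    {ζ : k} (hζ : IsPrimitiveRoot ζ ℓ) : ζ ^ ℓ.choose 2 = (-1) ^ (ℓ - 1) := by
  have hℓ := NeZero.pos ℓ
  rcases Nat.even_or_odd' ℓ with ⟨m, rfl | rfl⟩
  · rw [Nat.choose_two_right, mul_assoc, Nat.mul_div_cancel_left _ two_pos, pow_mul,
      (hζ.pow hℓ (mul_comm 2 m)).eq_neg_one_of_two_right]
  · rw [Nat.choose_two_right, Nat.add_sub_cancel, mul_left_comm,
      Nat.mul_div_cancel_left _ two_pos, pow_mul, hζ.pow_eq_one, one_pow, pow_mul, neg_one_sq,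
      one_pow]

variable [NeZero n] {ℓ : ℕ} [NeZero ℓ] {ζ : ℂ} (hζ : IsPrimitiveRoot ζ ℓ)

theorem twist_gen_neg_sub (hn : 2 ≤ n) (i : Fin n) :
    twist hζ (-Pi.single (i + 1) 1 + -Pi.single i 1) (gen hζ i) (gen hζ i) =
      if i.val + 1 = n then (zetaUnit hζ ^ (n - 2))⁻¹ else 1 := by
  have hne : i + 1 ≠ i := by
    rw [Ne, Fin.ext_iff, val_add_one]
    split_ifs <;> lia
  have hadd := twist_add_mul hζ (-Pi.single (i + 1) 1) (-Pi.single i 1) (gen hζ i) 1 (gen hζ i)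
  rw [one_mul, twist_one, weight_neg, weight_single, zpow_one, entryUnit_gen, if_neg hne,
    if_pos rfl, zero_sub, zpow_neg_one, inv_inv] at hadd
  rw [hadd]
  split_ifs with hi
  · rw [twist_gen_last hζ hi, show n - 1 = n - 2 + 1 by lia, pow_succ, mul_inv_rev,
      mul_inv_cancel_left]
  · rw [twist_gen_of_ne_last hζ hi hi, if_pos rfl, zpow_neg_one, mul_inv_cancel]

theorem torusGen_pow (hn : 2 ≤ n) (t : Fin n → ℂ) (i : Fin n) :
    torusGen hζ t (i + 1) ^ ℓ = mon hζ (ℓ • Pi.single (i + 1) 1) 1 -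
      tauTilde ℓ ζ t i • mon hζ (-(ℓ • Pi.single i 1)) 1 := by
  have hne : i + 1 ≠ i := by
    rw [Ne, Fin.ext_iff, val_add_one]
    split_ifs <;> lia
  set q : Fin n → ℤ := -Pi.single (i + 1) 1 + -Pi.single i 1 with hq
  set T := (t i / (ζ - 1)) • mon hζ q (gen hζ i) with hT
  have hXT : torusGen hζ t (i + 1) = torusX hζ (i + 1) * (1 - T) := by
    rw [torusGen, add_sub_cancel_right, torusY, mul_sub, mul_one, hT, mul_smul_comm, torusX,
      mon_one_mul_mon, add_neg_cancel_left]
  have hTX : T * torusX hζ (i + 1) = ζ⁻¹ • (torusX hζ (i + 1) * T) := by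
    rw [hT, smul_mul_assoc, mon_mul_torusX, mul_smul_comm, smul_comm, entry_gen, if_pos rfl,
      if_neg hne, one_mul]
  have hcoeff : (t i / (ζ - 1)) ^ ℓ * (twist hζ q (gen hζ i) (gen hζ i) : ℂ) ^ ℓ.choose 2 =
      tauTilde ℓ ζ t i := by
    rw [twist_gen_neg_sub hζ hn, tauTilde, tau]
    split_ifs with hi
    · have hsign : n * (ℓ - 1) = (ℓ - 1) * (n - 2) + 2 * (ℓ - 1) := by
        rw [mul_comm, mul_comm 2, ← mul_add, Nat.sub_add_cancel hn]
      rw [Units.val_inv_eq_inv_val, Units.val_pow_eq_pow_val, coe_zetaUnit, ← inv_pow,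
        ← pow_mul, mul_comm (n - 2), pow_mul, pow_choose_two_of_isPrimitiveRoot hζ.inv, ← pow_mul,
        mul_div_assoc, mul_pow ζ, hζ.pow_eq_one, one_mul, mul_comm, hsign, pow_add,
        pow_mul _ 2, neg_one_sq, one_pow, mul_one]
    · rw [Units.val_one, one_pow, mul_one]
  have hgen : gen hζ i ^ ℓ = 1 := Subtype.ext (gen hζ i).2.2
  rw [hXT, pow_mul_one_sub hζ.inv hTX, mul_sub, mul_one, torusX, mon_one_pow, hT, smul_pow, mon_pow,
    smul_smul, mul_smul_comm, hcoeff, hgen, mon_one_mul_mon, hq, smul_add, smul_neg, smul_neg,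
    add_neg_cancel_left]

end Powers

section OrderedMonomials

theorem prod_map_smul {ι k A : Type*} [CommSemiring k] [Semiring A] [Algebra k A] (c : ι → k)
    (f : ι → A) (l : List ι) :
    (l.map fun i => c i • f i).prod = (l.map c).prod • (l.map f).prod := by
  induction l with
  | nil => simp
  | cons a l ih =>
    rw [List.map_cons, List.prod_cons, ih, smul_mul_smul_comm, ← List.prod_cons, ← List.prod_cons,
      ← List.map_cons, ← List.map_cons]

variable {ℓ : ℕ} [NeZero ℓ] {ζ : ℂ} (hζ : IsPrimitiveRoot ζ ℓ)

theorem prod_ofFn_mon {m : ℕ} (p : Fin m → Fin n → ℤ) (g : Fin m → diagGroup n ℓ) :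
    (List.ofFn fun i => mon hζ (p i) (g i)).prod =
      ((∏ j, ∏ i ∈ Finset.Iio j, twist hζ (p j) (g j) (g i) : ℂˣ) : ℂ) •
        mon hζ (∑ i, p i) (∏ i, g i) := by
  induction m with
  | zero => simp [mon_zero_one]
  | succ m ih =>
    have hlast (f : Fin (m + 1) → ℂˣ) :
        ∏ i ∈ Finset.Iio (Fin.last m), f i = ∏ i : Fin m, f i.castSucc := by
      rw [Fin.Iio_last_eq_map, Finset.prod_map]
      rfl
    rw [List.ofFn_succ', List.concat_eq_append, List.prod_append, ih, List.prod_singleton,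
      smul_mul_assoc, mon_mul_mon, smul_smul, Fin.sum_univ_castSucc, Fin.prod_univ_castSucc g,
      Fin.prod_univ_castSucc, Units.val_mul, map_prod, hlast]
    simp only [Fin.prod_Iio_castSucc]

theorem prod_torusX : (List.ofFn (torusX (n := n) hζ)).prod = mon hζ 1 1 := by
  have hsum : ∑ i : Fin n, Pi.single i (1 : ℤ) = 1 := Finset.univ_sum_single 1
  unfold torusX
  simp only [prod_ofFn_mon, map_one, Finset.prod_const_one, Units.val_one, one_smul, hsum]

variable [NeZero n]

theorem prod_mon_gen : (List.ofFn fun i : Fin n => mon hζ (-Pi.single i 1) (gen hζ i)).prod =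
    ζ ^ (n - 1) • mon hζ (-1) 1 := by
  have hsum : ∑ i : Fin n, -Pi.single i (1 : ℤ) = -1 := by
    rw [Finset.sum_neg_distrib]
    exact congrArg Neg.neg (Finset.univ_sum_single 1)
  obtain ⟨m, rfl⟩ := Nat.exists_eq_add_one_of_ne_zero (NeZero.ne n)
  have hIio : ∀ j : Fin (m + 1),
      ∏ i ∈ Finset.Iio j, twist hζ (-Pi.single j 1) (gen hζ j) (gen hζ i) =
        if j = Fin.last m then zetaUnit hζ ^ m else 1 := fun j => by
    split_ifs with hj
    · subst hj
      rw [Finset.prod_congr rfl fun i hi => twist_gen_last_right hζ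
        (by have := Fin.lt_def.1 (Finset.mem_Iio.1 hi); simp at this; lia) (by simp),
        Finset.prod_const, Fin.card_Iio, Fin.val_last]
    · have hj' : j.val + 1 ≠ m + 1 := by rw [Fin.ext_iff, Fin.val_last] at hj; lia
      refine Finset.prod_eq_one fun i hi => ?_
      have hij := Fin.lt_def.1 (Finset.mem_Iio.1 hi)
      rw [twist_gen_of_ne_last hζ (by lia) hj', if_neg (Finset.mem_Iio.1 hi).ne', zpow_zero]
  rw [prod_ofFn_mon, hsum, prod_gen, Finset.prod_congr rfl fun j _ => hIio j,
    Finset.prod_ite_eq' , if_pos (Finset.mem_univ _), Units.val_pow_eq_pow_val, coe_zetaUnit,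
    Nat.add_sub_cancel]

theorem prod_tau (ζ : ℂ) (t : Fin n → ℂ) : ∏ i, tau ζ t i = ζ * ∏ i, t i / (ζ - 1) := by
  obtain ⟨m, rfl⟩ := Nat.exists_eq_add_one_of_ne_zero (NeZero.ne n)
  rw [Fin.prod_univ_castSucc, Fin.prod_univ_castSucc, tau, if_pos (by simp), mul_left_comm,
    mul_div_assoc]
  congr 2
  ext i
  rw [tau, if_neg]
  simpa using i.is_lt.ne

theorem prod_torusY (hn : 2 ≤ n) (t : Fin n → ℂ) :
    (List.ofFn (torusY hζ t)).prod = (ζ ^ (n - 2) * ∏ i, tau ζ t i) • mon hζ (-1) 1 := by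
  unfold torusY
  rw [List.ofFn_eq_map, prod_map_smul, ← List.ofFn_eq_map, ← List.ofFn_eq_map, List.prod_ofFn,
    prod_mon_gen, smul_smul, prod_tau, show n - 1 = n - 2 + 1 by lia, pow_succ]
  congr 1
  ring

/-- The image of the element `w` in the quantum torus. -/
def torusW (t : Fin n → ℂ) : Torus n hζ :=
  mon hζ 1 1 + ((-1) ^ n * ζ ^ (n - 2) * ∏ i, tau ζ t i) • mon hζ (-1) 1

theorem sum_indexJ_eq_torusW (hn : 3 ≤ n) (t : Fin n → ℂ) :
    ∑ S ∈ indexJ n, (∏ i ∈ S, tau ζ t i) •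
      ((List.ofFn fun j => torusGen hζ t j ^ (deltaSub S j).toNat).prod *
        (S.sort.map fun i => mon hζ 0 (gen hζ i)).prod) = torusW hζ t := by
  have hs (i : Fin n) : tau ζ t i • mon hζ 0 (gen hζ i) =
      if i.val + 1 = n then torusY hζ t i * torusX hζ i else torusX hζ i * torusY hζ t i := by
    have hne : i ≠ i + 1 := by
      rw [Ne, Fin.ext_iff, val_add_one]
      split_ifs <;> lia
    rw [torusY_mul_torusX, torusX_mul_torusY, entry_gen, if_pos rfl, if_neg hne, mul_one,
      smul_smul, tau]
    split_ifs
    · rw [mul_div_assoc]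
    · rfl
  have hfac := (cyclicallyCommuting_torusX_torusY hζ t).sum_indexJ hn (x := torusGen hζ t)
    (fun _ => rfl) hs
  rw [prod_torusX, prod_torusY hζ (by lia)] at hfac
  rw [torusW, mul_assoc, mul_smul, Algebra.smul_def ((-1 : ℂ) ^ n), map_pow, map_neg, map_one,
    ← hfac]
  refine Finset.sum_congr rfl fun S _ => ?_
  rw [prod_map_smul, mul_smul_comm, ← Finset.prod_map_toList,
    ((Finset.sort_perm_toList S _).map _).prod_eq]

end OrderedMonomials

section Filtration

variable {ℓ : ℕ} [NeZero ℓ] {ζ : ℂ}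

/-- The total degree of a Laurent monomial. -/
def totalDeg (p : Fin n → ℤ) : ℤ := ∑ j, p j

theorem totalDeg_add (p q : Fin n → ℤ) : totalDeg (p + q) = totalDeg p + totalDeg q := by
  simp [totalDeg, Finset.sum_add_distrib]

theorem totalDeg_neg (p : Fin n → ℤ) : totalDeg (-p) = -totalDeg p := by
  simp [totalDeg]

theorem totalDeg_single (i : Fin n) (c : ℤ) : totalDeg (Pi.single i c) = c := by
  simp [totalDeg]

theorem totalDeg_one : totalDeg (1 : Fin n → ℤ) = n := by
  simp [totalDeg]

/-- The elements of the quantum torus of total degree at most `d`. -/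
def fil (hζ : IsPrimitiveRoot ζ ℓ) (d : ℤ) : Submodule ℂ (Torus n hζ) :=
  Submodule.span ℂ {a | ∃ p g, totalDeg p ≤ d ∧ mon hζ p g = a}

variable {hζ : IsPrimitiveRoot ζ ℓ}

theorem mon_mem_fil {p : Fin n → ℤ} {d : ℤ} (h : totalDeg p ≤ d) (g : diagGroup n ℓ) :
    mon hζ p g ∈ fil hζ d := Submodule.subset_span ⟨p, g, h, rfl⟩

theorem fil_mono {d e : ℤ} (h : d ≤ e) : fil (n := n) hζ d ≤ fil hζ e :=
  Submodule.span_mono fun _ ⟨p, g, hp, ha⟩ => ⟨p, g, hp.trans h, ha⟩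

theorem coefAt_eq_zero_of_mem_fil {a : Torus n hζ} {d : ℤ} (ha : a ∈ fil hζ d) {p : Fin n → ℤ}
    (hp : d < totalDeg p) (g : diagGroup n ℓ) : coefAt hζ p g a = 0 := by
  induction ha using Submodule.span_induction with
  | mem a ha =>
    obtain ⟨q, h, hq, rfl⟩ := ha
    rw [coefAt_mon, if_neg]
    rintro ⟨rfl, -⟩
    exact absurd hp (not_lt.2 hq)
  | zero => exact map_zero _
  | add a b _ _ ha hb => rw [map_add, ha, hb, add_zero]
  | smul c a _ ha => rw [map_smul, ha, smul_zero]

theorem eq_sum_mon (a : Torus n hζ) :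
    a = ∑ u ∈ a.coeff.support, coefAt hζ u.1.toAdd u.2 a • mon hζ u.1.toAdd u.2 := by
  ext1
  refine (Finsupp.sum_single a.coeff).symm.trans ?_
  refine Eq.trans ?_ (map_sum (CrossedProduct.coeffLinear (k := ℂ)) _ _).symm
  refine Finset.sum_congr rfl fun u _ => ?_
  change Finsupp.single u (a.coeff u) = a.coeff u • Finsupp.single u (1 : ℂ)
  rw [Finsupp.smul_single, smul_eq_mul, mul_one]

theorem exists_mem_fil (a : Torus n hζ) : ∃ d : ℕ, a ∈ fil hζ d := by
  refine ⟨∑ u ∈ a.coeff.support, (totalDeg u.1.toAdd).toNat, ?_⟩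
  rw [eq_sum_mon a]
  refine Submodule.sum_mem _ fun u hu => Submodule.smul_mem _ _ (mon_mem_fil ?_ _)
  rw [← eq_sum_mon a]
  have := Finset.single_le_sum (f := fun u : TorusGroup n ℓ => (totalDeg u.1.toAdd).toNat)
    (fun _ _ => Nat.zero_le _) hu
  lia

theorem mul_mem_fil {a b : Torus n hζ} {d e : ℤ} (ha : a ∈ fil hζ d) (hb : b ∈ fil hζ e) :
    a * b ∈ fil hζ (d + e) := by
  have h : fil (n := n) hζ d * fil hζ e ≤ fil hζ (d + e) := by
    rw [fil, fil, Submodule.span_mul_span, Submodule.span_le]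
    rintro _ ⟨_, ⟨p, g, hp, rfl⟩, _, ⟨q, h, hq, rfl⟩, rfl⟩
    dsimp only
    rw [mon_mul_mon]
    refine Submodule.smul_mem _ _ (mon_mem_fil ?_ _)
    rw [totalDeg_add]
    exact add_le_add hp hq
  exact h (Submodule.mul_mem_mul ha hb)

/-- The element `a` is the Laurent monomial with exponent `p` times `g` plus terms of smaller total
degree. -/
def HasLead (a : Torus n hζ) (p : Fin n → ℤ) (g : diagGroup n ℓ) : Prop :=
  a - mon hζ p g ∈ fil hζ (totalDeg p - 1)

theorem hasLead_mon (p : Fin n → ℤ) (g : diagGroup n ℓ) : HasLead (mon hζ p g) p g := by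
  rw [HasLead, sub_self]
  exact Submodule.zero_mem _

theorem HasLead.mem_fil {a : Torus n hζ} {p : Fin n → ℤ} {g : diagGroup n ℓ} (h : HasLead a p g) :
    a ∈ fil hζ (totalDeg p) := by
  rw [← sub_add_cancel a (mon hζ p g)]
  exact Submodule.add_mem _ (fil_mono (by lia) h) (mon_mem_fil le_rfl g)

theorem HasLead.mul {a b : Torus n hζ} {p q : Fin n → ℤ} {h : diagGroup n ℓ}
    (ha : HasLead a p 1) (hb : HasLead b q h) : HasLead (a * b) (p + q) h := by
  rw [HasLead, ← mon_one_mul_mon, totalDeg_add]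
  have : a * b - mon hζ p 1 * mon hζ q h =
      (a - mon hζ p 1) * b + mon hζ p 1 * (b - mon hζ q h) := by noncomm_ring
  rw [this]
  refine Submodule.add_mem _ ?_ ?_
  · have := mul_mem_fil ha hb.mem_fil
    rwa [show totalDeg p + totalDeg q - 1 = totalDeg p - 1 + totalDeg q by ring]
  · have := mul_mem_fil (mon_mem_fil (hζ := hζ) (le_refl (totalDeg p)) 1) hb
    rwa [show totalDeg p + totalDeg q - 1 = totalDeg p + (totalDeg q - 1) by ring]

theorem HasLead.pow {a : Torus n hζ} {p : Fin n → ℤ} (ha : HasLead a p 1) (k : ℕ) :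
    HasLead (a ^ k) (k • p) 1 := by
  induction k with
  | zero =>
    rw [pow_zero, zero_smul, ← mon_zero_one]
    exact hasLead_mon _ _
  | succ k ih =>
    rw [pow_succ, succ_nsmul]
    exact ih.mul ha

theorem HasLead.coefAt_self {a : Torus n hζ} {p : Fin n → ℤ} {g : diagGroup n ℓ}
    (h : HasLead a p g) : coefAt hζ p g a = 1 := by
  have := coefAt_eq_zero_of_mem_fil h (p := p) (by lia) g
  rw [map_sub, sub_eq_zero] at this
  rw [this, coefAt_mon, if_pos ⟨rfl, rfl⟩]

theorem HasLead.coefAt_eq_zero {a : Torus n hζ} {p q : Fin n → ℤ} {g h : diagGroup n ℓ}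
    (ha : HasLead a p g) (hne : (q, h) ≠ (p, g)) (hd : totalDeg p ≤ totalDeg q) :
    coefAt hζ q h a = 0 := by
  have := coefAt_eq_zero_of_mem_fil ha (p := q) (by lia) h
  rw [map_sub, sub_eq_zero] at this
  rw [this, coefAt_mon, if_neg]
  rintro ⟨rfl, rfl⟩
  exact hne rfl

theorem exists_mem_sub_mem_fil {W : Submodule ℂ (Torus n hζ)} {a : Torus n hζ} {d : ℤ}
    (ha : a ∈ fil hζ d)
    (hW : ∀ p g, totalDeg p = d → coefAt hζ p g a ≠ 0 → ∃ b ∈ W, HasLead b p g) :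
    ∃ b ∈ W, a - b ∈ fil hζ (d - 1) := by
  have hterm (u : TorusGroup n ℓ) :
      ∃ b ∈ W, coefAt hζ u.1.toAdd u.2 a • mon hζ u.1.toAdd u.2 - b ∈ fil hζ (d - 1) := by
    by_cases hu : coefAt hζ u.1.toAdd u.2 a = 0
    · exact ⟨0, W.zero_mem, by simp [hu]⟩
    rcases lt_trichotomy (totalDeg u.1.toAdd) d with hlt | heq | hgt
    · refine ⟨0, W.zero_mem, ?_⟩
      rw [sub_zero]
      exact Submodule.smul_mem _ _ (mon_mem_fil (by lia) _)
    · obtain ⟨b, hbW, hb⟩ := hW _ _ heq hu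
      refine ⟨coefAt hζ u.1.toAdd u.2 a • b, W.smul_mem _ hbW, ?_⟩
      rw [HasLead, heq] at hb
      rw [← smul_sub, ← neg_sub b]
      exact Submodule.smul_mem _ _ (Submodule.neg_mem _ hb)
    · exact absurd (coefAt_eq_zero_of_mem_fil ha hgt _) hu
  choose b hbW hb using hterm
  refine ⟨∑ u ∈ a.coeff.support, b u, W.sum_mem fun u _ => hbW u, ?_⟩
  have hsum := Submodule.sum_mem (fil hζ (d - 1)) (t := a.coeff.support) fun u _ => hb u
  rwa [Finset.sum_sub_distrib, ← eq_sum_mon a] at hsum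

variable {I : Type*} {v : I → Torus n hζ} {e : I → (Fin n → ℤ) × diagGroup n ℓ}

theorem totalDeg_le_of_linearCombination_mem_fil (he : Function.Injective e)
    (hv : ∀ i, HasLead (v i) (e i).1 (e i).2) {c : I →₀ ℂ} {d : ℤ}
    (hc : Finsupp.linearCombination ℂ v c ∈ fil hζ d) {i : I} (hi : i ∈ c.support) :
    totalDeg (e i).1 ≤ d := by
  obtain ⟨k, hk, hmax⟩ := c.support.exists_max_image (fun i => totalDeg (e i).1) ⟨i, hi⟩
  by_contra hd
  have hki := hmax i hi
  have h0 := coefAt_eq_zero_of_mem_fil hc (p := (e k).1) (by lia) (e k).2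
  rw [Finsupp.linearCombination_apply, Finsupp.sum, map_sum, Finset.sum_eq_single k] at h0
  · rw [map_smul, (hv k).coefAt_self, smul_eq_mul, mul_one] at h0
    exact (Finsupp.mem_support_iff.1 hk) h0
  · intro j hj hjk
    rw [map_smul, (hv j).coefAt_eq_zero (fun h => hjk (he h).symm) (hmax j hj), smul_zero]
  · exact fun h => absurd hk h

theorem linearIndependent_of_hasLead (he : Function.Injective e)
    (hv : ∀ i, HasLead (v i) (e i).1 (e i).2) : LinearIndependent ℂ v := by
  rw [linearIndependent_iff]
  intro c hc
  by_contra hne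
  obtain ⟨i, hi⟩ := Finsupp.support_nonempty_iff.2 hne
  have := totalDeg_le_of_linearCombination_mem_fil he hv (c := c) (d := totalDeg (e i).1 - 1)
    (by rw [hc]; exact Submodule.zero_mem _) hi
  lia

theorem exists_eq_of_coefAt_ne_zero (he : Function.Injective e)
    (hv : ∀ i, HasLead (v i) (e i).1 (e i).2) {c : I →₀ ℂ} {d : ℤ}
    (hc : Finsupp.linearCombination ℂ v c ∈ fil hζ d) {p : Fin n → ℤ} {g : diagGroup n ℓ}
    (hp : totalDeg p = d) (h : coefAt hζ p g (Finsupp.linearCombination ℂ v c) ≠ 0) :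
    ∃ i, e i = (p, g) := by
  by_contra! hne
  apply h
  rw [Finsupp.linearCombination_apply, Finsupp.sum, map_sum]
  refine Finset.sum_eq_zero fun i hi => ?_
  have := totalDeg_le_of_linearCombination_mem_fil he hv hc hi
  rw [map_smul, (hv i).coefAt_eq_zero (hne i).symm (by lia), smul_zero]

end Filtration

section PBW

theorem mulVec_single {ℓ : ℕ} (g : diagGroup n ℓ) (i : Fin n) :
    Matrix.mulVec ((g : Matrix.SpecialLinearGroup (Fin n) ℂ) : Matrix (Fin n) (Fin n) ℂ)
      (Pi.single i 1) = entry g i • Pi.single i 1 := by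
  rw [coe_eq_diagonal]
  ext j
  rw [Matrix.mulVec_diagonal, Pi.smul_apply, smul_eq_mul]
  rcases eq_or_ne j i with rfl | h
  · rfl
  · simp [h]

variable {ℓ : ℕ} [NeZero ℓ] {ζ : ℂ} [NeZero n] (hζ : IsPrimitiveRoot ζ ℓ) (t : Fin n → ℂ)

/-- The image of a group element in the Hecke algebra. -/
def heckeGrp (g : diagGroup n ℓ) : Hecke hζ t := RingQuot.mkAlgHom ℂ (HeckeRel hζ t) (preG hζ g)

theorem heckeGrp_mul (g h : diagGroup n ℓ) :
    heckeGrp hζ t g * heckeGrp hζ t h = (cocycleFun hζ g h : ℂ) • heckeGrp hζ t (g * h) := by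
  rw [heckeGrp, heckeGrp, heckeGrp, ← map_mul, ← map_smul, preG, preG, preG,
    CrossedProduct.single_mul_single, CrossedProduct.smul_single, map_one, mul_one, Units.smul_def]
  rfl

theorem heckeGrp_mul_heckeX (g : diagGroup n ℓ) (i : Fin n) :
    heckeGrp hζ t g * heckeX hζ t i = entry g i • (heckeX hζ t i * heckeGrp hζ t g) := by
  rw [heckeGrp, heckeX, ← map_mul, ← map_mul, ← map_smul, preG, preX,
    CrossedProduct.single_mul_single, CrossedProduct.single_mul_single, CrossedProduct.smul_single,
    (cocycle n hζ).map_one_left, (cocycle n hζ).map_one_right, tensorAction_ι, mulVec_single,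
    map_smul, map_one, one_mul, mul_one, mul_one, one_mul, one_smul, one_smul]

theorem exists_heckeX_commutator (hn : 3 ≤ n) (i j : Fin n) : ∃ (c : ℂ) (g : diagGroup n ℓ),
    heckeX hζ t i * heckeX hζ t j - heckeX hζ t j * heckeX hζ t i = c • heckeGrp hζ t g := by
  have hadj : ∀ i : Fin n, heckeX hζ t i * heckeX hζ t (i + 1) -
      heckeX hζ t (i + 1) * heckeX hζ t i = t i • heckeGrp hζ t (gen hζ i) := fun i => by
    have := RingQuot.mkAlgHom_rel ℂ (HeckeRel.adjacent (hζ := hζ) (t := t) i)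
    rw [map_sub, map_mul, map_mul, map_smul] at this
    exact this
  by_cases h : NonAdjacent i j
  · have := RingQuot.mkAlgHom_rel ℂ (HeckeRel.nonAdjacent (hζ := hζ) (t := t) i j h)
    rw [map_sub, map_mul, map_mul, map_zero] at this
    exact ⟨0, 1, by rw [zero_smul]; exact this⟩
  · rw [nonAdjacent_iff hn, not_and_or, not_not, not_not] at h
    rcases h with rfl | rfl
    · exact ⟨_, _, hadj i⟩
    · exact ⟨-t j, gen hζ j, by rw [neg_smul, ← hadj j, neg_sub]⟩

/-- The product of the generators `x_i` along a list of indices. -/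
def word (l : List (Fin n)) : Hecke hζ t := (l.map (heckeX hζ t)).prod

theorem word_cons (i : Fin n) (l : List (Fin n)) :
    word hζ t (i :: l) = heckeX hζ t i * word hζ t l := by
  rw [word, List.map_cons, List.prod_cons, word]

theorem exists_heckeGrp_mul_word (g : diagGroup n ℓ) (l : List (Fin n)) :
    ∃ c : ℂ, heckeGrp hζ t g * word hζ t l = c • (word hζ t l * heckeGrp hζ t g) := by
  induction l with
  | nil => exact ⟨1, by simp [word]⟩
  | cons i l ih =>
    obtain ⟨c, hc⟩ := ih
    refine ⟨entry g i * c, ?_⟩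
    rw [word_cons, ← mul_assoc, heckeGrp_mul_heckeX, smul_mul_assoc, mul_assoc, hc, mul_smul_comm,
      smul_smul, mul_assoc]

/-- The span of the products of words of length less than `d` with group elements. -/
def wordSpan (d : ℕ) : Submodule ℂ (Hecke hζ t) :=
  Submodule.span ℂ {a | ∃ l g, l.length < d ∧ word hζ t l * heckeGrp hζ t g = a}

theorem heckeX_mul_mem_wordSpan (i : Fin n) {d : ℕ} {a : Hecke hζ t} (ha : a ∈ wordSpan hζ t d) :
    heckeX hζ t i * a ∈ wordSpan hζ t (d + 1) := by
  induction ha using Submodule.span_induction with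
  | mem a ha =>
    obtain ⟨l, g, hl, rfl⟩ := ha
    refine Submodule.subset_span ⟨i :: l, g, by simpa using hl, ?_⟩
    rw [word_cons, mul_assoc]
  | zero => rw [mul_zero]; exact Submodule.zero_mem _
  | add a b _ _ ha hb => rw [mul_add]; exact Submodule.add_mem _ ha hb
  | smul c a _ ha => rw [mul_smul_comm]; exact Submodule.smul_mem _ _ ha

theorem mul_heckeGrp_mem_wordSpan (g : diagGroup n ℓ) {d : ℕ} {a : Hecke hζ t}
    (ha : a ∈ wordSpan hζ t d) : a * heckeGrp hζ t g ∈ wordSpan hζ t d := by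
  induction ha using Submodule.span_induction with
  | mem a ha =>
    obtain ⟨l, h, hl, rfl⟩ := ha
    rw [mul_assoc, heckeGrp_mul, mul_smul_comm]
    exact Submodule.smul_mem _ _ (Submodule.subset_span ⟨l, h * g, hl, rfl⟩)
  | zero => rw [zero_mul]; exact Submodule.zero_mem _
  | add a b _ _ ha hb => rw [add_mul]; exact Submodule.add_mem _ ha hb
  | smul c a _ ha => rw [smul_mul_assoc]; exact Submodule.smul_mem _ _ ha

theorem word_sub_word_mem_wordSpan (hn : 3 ≤ n) {l l' : List (Fin n)} (h : l.Perm l') :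
    word hζ t l - word hζ t l' ∈ wordSpan hζ t l.length := by
  induction h with
  | nil => rw [sub_self]; exact Submodule.zero_mem _
  | cons i _ ih =>
    rw [word_cons, word_cons, ← mul_sub]
    exact heckeX_mul_mem_wordSpan hζ t i ih
  | swap i j l =>
    obtain ⟨c, g, hc⟩ := exists_heckeX_commutator hζ t hn j i
    obtain ⟨c', hc'⟩ := exists_heckeGrp_mul_word hζ t g l
    rw [word_cons, word_cons, word_cons, word_cons, ← mul_assoc, ← mul_assoc, ← sub_mul, hc,
      smul_mul_assoc, hc']
    refine Submodule.smul_mem _ _ (Submodule.smul_mem _ _ (Submodule.subset_span ⟨l, g, ?_, rfl⟩))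
    simp
  | trans hperm _ ih ih' =>
    rw [← hperm.length_eq] at ih'
    rw [← sub_add_sub_cancel]
    exact Submodule.add_mem _ ih ih'

/-- The elements of the basis of the Hecke algebra. -/
def pbw (u : Multiset (Fin n) × diagGroup n ℓ) : Hecke hζ t :=
  word hζ t u.1.toList * heckeGrp hζ t u.2

theorem wordSpan_le_span_pbw (hn : 3 ≤ n) (d : ℕ) :
    wordSpan hζ t d ≤ Submodule.span ℂ (Set.range (pbw hζ t)) := by
  induction d with
  | zero =>
    rw [wordSpan, Submodule.span_le]
    rintro _ ⟨l, g, hl, rfl⟩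
    exact absurd hl (Nat.not_lt_zero _)
  | succ d ih =>
    rw [wordSpan, Submodule.span_le]
    rintro _ ⟨l, g, hl, rfl⟩
    have hperm : l.Perm (l : Multiset (Fin n)).toList :=
      Multiset.coe_eq_coe.1 (Multiset.coe_toList _).symm
    have hle : wordSpan hζ t l.length ≤ wordSpan hζ t d :=
      Submodule.span_mono fun _ ⟨l', g, hl', ha⟩ => ⟨l', g, by lia, ha⟩
    have hdiff := ih (hle (mul_heckeGrp_mem_wordSpan hζ t g
      (word_sub_word_mem_wordSpan hζ t hn hperm)))
    rw [sub_mul] at hdiff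
    rw [SetLike.mem_coe, ← sub_add_cancel (word hζ t l * heckeGrp hζ t g)]
    exact Submodule.add_mem _ hdiff (Submodule.subset_span ⟨((l : Multiset (Fin n)), g), rfl⟩)

theorem heckeX_mul_mem_span_pbw (hn : 3 ≤ n) (i : Fin n) {a : Hecke hζ t}
    (ha : a ∈ Submodule.span ℂ (Set.range (pbw hζ t))) :
    heckeX hζ t i * a ∈ Submodule.span ℂ (Set.range (pbw hζ t)) := by
  induction ha using Submodule.span_induction with
  | mem a ha =>
    obtain ⟨⟨m, g⟩, rfl⟩ := ha
    exact wordSpan_le_span_pbw hζ t hn _ (heckeX_mul_mem_wordSpan hζ t i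
      (Submodule.subset_span ⟨m.toList, g, Nat.lt_succ_self _, rfl⟩))
  | zero => rw [mul_zero]; exact Submodule.zero_mem _
  | add a b _ _ ha hb => rw [mul_add]; exact Submodule.add_mem _ ha hb
  | smul c a _ ha => rw [mul_smul_comm]; exact Submodule.smul_mem _ _ ha

/-- The algebra homomorphism from the tensor algebra to the Hecke algebra. -/
def tensorToHecke : TensorAlgebra ℂ (Fin n → ℂ) →ₐ[ℂ] Hecke hζ t :=
  (RingQuot.mkAlgHom ℂ (HeckeRel hζ t)).comp CrossedProduct.inclusion

theorem tensorToHecke_ι (v : Fin n → ℂ) :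
    tensorToHecke hζ t (TensorAlgebra.ι ℂ v) = ∑ i, v i • heckeX hζ t i := by
  conv_lhs => rw [pi_eq_sum_univ' v, map_sum, map_sum]
  refine Finset.sum_congr rfl fun i _ => ?_
  rw [map_smul, map_smul]
  rfl

theorem tensorToHecke_mul_mem_span_pbw (hn : 3 ≤ n) (r : TensorAlgebra ℂ (Fin n → ℂ))
    {a : Hecke hζ t} (ha : a ∈ Submodule.span ℂ (Set.range (pbw hζ t))) :
    tensorToHecke hζ t r * a ∈ Submodule.span ℂ (Set.range (pbw hζ t)) := by
  induction r using TensorAlgebra.induction generalizing a with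
  | algebraMap c =>
    rw [AlgHom.commutes, ← Algebra.smul_def]
    exact Submodule.smul_mem _ _ ha
  | ι v =>
    rw [tensorToHecke_ι, Finset.sum_mul]
    refine Submodule.sum_mem _ fun i _ => ?_
    rw [smul_mul_assoc]
    exact Submodule.smul_mem _ _ (heckeX_mul_mem_span_pbw hζ t hn i ha)
  | mul r s hr hs =>
    rw [map_mul, mul_assoc]
    exact hr (hs ha)
  | add r s hr hs =>
    rw [map_add, add_mul]
    exact Submodule.add_mem _ (hr ha) (hs ha)

theorem span_pbw (hn : 3 ≤ n) : Submodule.span ℂ (Set.range (pbw hζ t)) = ⊤ := by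
  rw [eq_top_iff]
  intro a _
  obtain ⟨b, rfl⟩ := RingQuot.mkAlgHom_surjective ℂ (HeckeRel hζ t) a
  induction b using CrossedProduct.induction_on with
  | h0 => rw [map_zero]; exact Submodule.zero_mem _
  | hadd a b ha hb =>
    rw [map_add]
    exact Submodule.add_mem _ (ha trivial) (hb trivial)
  | hs g r =>
    rw [CrossedProduct.single_eq_inclusion_mul, map_mul]
    exact tensorToHecke_mul_mem_span_pbw hζ t hn r
      (Submodule.subset_span ⟨(0, g), by simp [pbw, word, heckeGrp, preG]⟩)

end PBW

section Embedding

variable {ℓ : ℕ} [NeZero ℓ] {ζ : ℂ} [NeZero n]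

/-- The homomorphism from `TV #_α G` to the quantum torus. -/
def tensorToTorus (hζ : IsPrimitiveRoot ζ ℓ) (t : Fin n → ℂ) :
    TensorCrossed n hζ →ₐ[ℂ] Torus n hζ :=
  CrossedProduct.lift (TensorAlgebra.lift ℂ (Fintype.linearCombination ℂ (torusGen hζ t)))
    (mon hζ 0) (mon_zero_one hζ)
    (fun g h => by rw [mon_mul_mon, twist_zero, add_zero]; rfl)
    (fun g r => by
      induction r using TensorAlgebra.induction with
      | algebraMap c =>
        rw [AlgEquiv.commutes, AlgHom.commutes, Algebra.commutes]
      | ι v =>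
        rw [tensorAction_ι, TensorAlgebra.lift_ι_apply, TensorAlgebra.lift_ι_apply,
          Fintype.linearCombination_apply, Fintype.linearCombination_apply, Finset.mul_sum,
          Finset.sum_mul]
        refine Finset.sum_congr rfl fun i _ => ?_
        rw [coe_eq_diagonal, Matrix.mulVec_diagonal, mul_smul_comm, mon_mul_torusGen hζ t,
          smul_mul_assoc, smul_smul, mul_comm]
      | mul r s hr hs => rw [map_mul, map_mul, map_mul, ← mul_assoc, hr, mul_assoc, hs, mul_assoc]
      | add r s hr hs => rw [map_add, map_add, map_add, mul_add, add_mul, hr, hs])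

theorem tensorToTorus_preX (hζ : IsPrimitiveRoot ζ ℓ) (t : Fin n → ℂ) (i : Fin n) :
    tensorToTorus hζ t (preX hζ i) = torusGen hζ t i := by
  rw [tensorToTorus, preX, CrossedProduct.lift_single, TensorAlgebra.lift_ι_apply, mon_zero_one,
    mul_one]
  simp [Fintype.linearCombination_apply, Pi.single_apply]

theorem tensorToTorus_preG (hζ : IsPrimitiveRoot ζ ℓ) (t : Fin n → ℂ)
    (g : diagGroup n ℓ) : tensorToTorus hζ t (preG hζ g) = mon hζ 0 g := by
  rw [tensorToTorus, preG, CrossedProduct.lift_single, map_one, one_mul]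

/-- The homomorphism from the Hecke algebra to the quantum torus. -/
def heckeToTorus (hn : 3 ≤ n) (hζ1 : ζ ≠ 1) (hζ : IsPrimitiveRoot ζ ℓ) (t : Fin n → ℂ) :
    Hecke hζ t →ₐ[ℂ] Torus n hζ :=
  RingQuot.liftAlgHom ℂ ⟨tensorToTorus hζ t, fun x y h => by
    cases h with
    | adjacent i =>
      rw [map_sub, map_mul, map_mul, map_smul, tensorToTorus_preX, tensorToTorus_preX,
        tensorToTorus_preG, torusGen_adjacent hζ t hn hζ1]
    | nonAdjacent i j h =>
      rw [map_sub, map_mul, map_mul, map_zero, tensorToTorus_preX, tensorToTorus_preX,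
        torusGen_nonAdjacent hζ t hn h]⟩

variable (hn : 3 ≤ n) (hζ1 : ζ ≠ 1) (hζ : IsPrimitiveRoot ζ ℓ) (t : Fin n → ℂ)

theorem heckeToTorus_heckeX (i : Fin n) :
    heckeToTorus hn hζ1 hζ t (heckeX hζ t i) = torusGen hζ t i := by
  rw [heckeToTorus, heckeX, RingQuot.liftAlgHom_mkAlgHom_apply, tensorToTorus_preX]

theorem heckeToTorus_heckeGrp (g : diagGroup n ℓ) :
    heckeToTorus hn hζ1 hζ t (heckeGrp hζ t g) = mon hζ 0 g := by
  rw [heckeToTorus, heckeGrp, RingQuot.liftAlgHom_mkAlgHom_apply, tensorToTorus_preG]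

theorem heckeToTorus_heckeW : heckeToTorus hn hζ1 hζ t (heckeW hζ t) = torusW hζ t := by
  rw [← sum_indexJ_eq_torusW hζ hn, heckeW, map_sum]
  refine Finset.sum_congr rfl fun S _ => ?_
  rw [map_smul, map_mul, map_list_prod, map_list_prod, List.map_ofFn, List.map_map]
  congr 4
  · funext j
    simp [heckeToTorus_heckeX]
  · funext i
    exact heckeToTorus_heckeGrp hn hζ1 hζ t (gen hζ i)

theorem hasLead_torusGen (i : Fin n) : HasLead (torusGen hζ t i) (Pi.single i 1) 1 := by
  rw [HasLead, torusGen, torusX, sub_sub_cancel_left, torusY]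
  refine Submodule.neg_mem _ (Submodule.smul_mem _ _ (mon_mem_fil ?_ _))
  rw [totalDeg_neg, totalDeg_single, totalDeg_single]
  norm_num

theorem hasLead_word (l : List (Fin n)) : HasLead (heckeToTorus hn hζ1 hζ t (word hζ t l))
    (fun j => (l.count j : ℤ)) 1 := by
  induction l with
  | nil =>
    have : (fun j : Fin n => (([] : List (Fin n)).count j : ℤ)) = 0 := by ext; simp
    rw [this, word, List.map_nil, List.prod_nil, map_one, ← mon_zero_one]
    exact hasLead_mon _ _
  | cons i l ih =>
    have : (fun j : Fin n => ((i :: l).count j : ℤ)) =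
        Pi.single i 1 + fun j => (l.count j : ℤ) := by
      ext j
      rw [List.count_cons, Pi.add_apply, Pi.single_apply, add_comm]
      push_cast
      congr 1
      simp only [beq_iff_eq, eq_comm (a := i)]
    rw [this, word_cons, map_mul, heckeToTorus_heckeX]
    exact (hasLead_torusGen hζ t i).mul ih

/-- The exponents of the leading terms of the basis elements. -/
def pbwExp (u : Multiset (Fin n) × diagGroup n ℓ) : (Fin n → ℤ) × diagGroup n ℓ :=
  (fun j => (u.1.count j : ℤ), u.2)

omit [NeZero ℓ] [NeZero n] in
theorem pbwExp_injective : Function.Injective (pbwExp (n := n) (ℓ := ℓ)) := by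
  rintro ⟨m, g⟩ ⟨m', g'⟩ h
  rw [pbwExp, pbwExp, Prod.mk.injEq] at h
  obtain ⟨hcount, rfl⟩ := h
  congr 1
  ext j
  exact_mod_cast congrFun hcount j

theorem hasLead_pbw (u : Multiset (Fin n) × diagGroup n ℓ) :
    HasLead (heckeToTorus hn hζ1 hζ t (pbw hζ t u)) (pbwExp u).1 (pbwExp u).2 := by
  have h := (hasLead_word hn hζ1 hζ t u.1.toList).mul (hasLead_mon (hζ := hζ) 0 u.2)
  rw [add_zero, ← heckeToTorus_heckeGrp hn hζ1 hζ t, ← map_mul] at h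
  have hexp : (fun j => (u.1.toList.count j : ℤ)) = (pbwExp u).1 := by
    ext j
    rw [pbwExp, ← Multiset.coe_count, Multiset.coe_toList]
  rwa [hexp] at h
theorem heckeToTorus_injective : Function.Injective (heckeToTorus hn hζ1 hζ t) :=
  LinearMap.injective_of_linearIndependent (f := (heckeToTorus hn hζ1 hζ t).toLinearMap)
    (span_pbw hζ t hn) (linearIndependent_of_hasLead pbwExp_injective (hasLead_pbw hn hζ1 hζ t))

theorem exists_linearCombination_eq_heckeToTorus (a : Hecke hζ t) :
    ∃ c, Finsupp.linearCombination ℂ (fun u => heckeToTorus hn hζ1 hζ t (pbw hζ t u)) c =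
      heckeToTorus hn hζ1 hζ t a := by
  have ha : a ∈ Submodule.span ℂ (Set.range (pbw hζ t)) := by rw [span_pbw hζ t hn]; trivial
  obtain ⟨c, rfl⟩ := Finsupp.mem_span_range_iff_exists_finsupp.1 ha
  exact ⟨c, by simp [Finsupp.linearCombination_apply, map_finsuppSum]⟩

variable {hn hζ1 hζ t}

theorem zero_le_of_coefAt_heckeToTorus_ne_zero {a : Hecke hζ t} {d : ℤ}
    (ha : heckeToTorus hn hζ1 hζ t a ∈ fil hζ d) {p : Fin n → ℤ} {g : diagGroup n ℓ}
    (hp : totalDeg p = d) (h : coefAt hζ p g (heckeToTorus hn hζ1 hζ t a) ≠ 0) : 0 ≤ p := by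
  obtain ⟨c, hc⟩ := exists_linearCombination_eq_heckeToTorus hn hζ1 hζ t a
  rw [← hc] at ha h
  obtain ⟨u, hu⟩ := exists_eq_of_coefAt_ne_zero pbwExp_injective (hasLead_pbw hn hζ1 hζ t) ha hp h
  rw [show p = (pbwExp u).1 from (congrArg Prod.fst hu).symm]
  exact fun j => Int.natCast_nonneg _

theorem heckeToTorus_eq_zero_of_mem_fil {a : Hecke hζ t} {d : ℤ} (hd : d < 0)
    (ha : heckeToTorus hn hζ1 hζ t a ∈ fil hζ d) : heckeToTorus hn hζ1 hζ t a = 0 := by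
  obtain ⟨c, hc⟩ := exists_linearCombination_eq_heckeToTorus hn hζ1 hζ t a
  rw [← hc] at ha ⊢
  suffices c = 0 by rw [this, map_zero]
  refine Finsupp.support_eq_empty.1 (Finset.eq_empty_of_forall_notMem fun u hu => ?_)
  have hle := totalDeg_le_of_linearCombination_mem_fil pbwExp_injective
    (hasLead_pbw hn hζ1 hζ t) ha hu
  have hnonneg : 0 ≤ totalDeg (pbwExp u).1 := Finset.sum_nonneg fun j _ => Int.natCast_nonneg _
  lia

end Embedding

section PowerSums

theorem nu_zero {m : ℕ} (hm : m ≠ 0) : nu m 0 = 1 := by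
  have : (m : ℂ) ≠ 0 := Nat.cast_ne_zero.2 hm
  simp [nu, this]

theorem nu_eq_zero {m r : ℕ} (h : m < 2 * r) : nu m r = 0 := by
  rw [nu, Nat.choose_eq_zero_of_lt (by lia), Nat.cast_zero, mul_zero]

theorem nu_two_one : nu 2 1 = -2 := by
  norm_num [nu]

theorem nu_add_two {m : ℕ} (hm : m ≠ 0) (r : ℕ) :
    nu (m + 2) (r + 1) = nu (m + 1) (r + 1) - nu m r := by
  rcases Nat.lt_or_ge r m with h | h
  · obtain ⟨k, rfl⟩ : ∃ k, m = r + k + 1 := ⟨m - r - 1, by lia⟩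
    have hpascal : ((k + 2).choose (r + 1) : ℂ) = (k + 1).choose r + (k + 1).choose (r + 1) :=
      mod_cast Nat.choose_succ_succ' (k + 1) r
    have habsorb : ((k + 2 : ℕ) : ℂ) * (k + 1).choose r = (k + 2).choose (r + 1) * (r + 1 : ℕ) :=
      mod_cast Nat.add_one_mul_choose_eq (k + 1) r
    have hk : (k : ℂ) + 1 ≠ 0 := Nat.cast_add_one_ne_zero k
    have hk' : (k : ℂ) + 2 ≠ 0 := mod_cast (k + 1).succ_ne_zero
    simp only [nu, show r + k + 1 + 2 - (r + 1) = k + 2 by lia,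
      show r + k + 1 + 1 - (r + 1) = k + 1 by lia, show r + k + 1 - r = k + 1 by lia]
    push_cast at habsorb ⊢
    rw [show (r + k + 1 + 2 - (r + 1) : ℂ) = k + 2 by ring,
      show (r + k + 1 + 1 - (r + 1) : ℂ) = k + 1 by ring, show (r + k + 1 - r : ℂ) = k + 1 by ring,
      pow_succ]
    rw [hpascal] at habsorb ⊢
    field_simp
    linear_combination (-habsorb)
  · rw [nu_eq_zero (by lia), nu_eq_zero (by lia), nu_eq_zero (by lia), sub_zero]

variable {A : Type*} [CommRing A] [Algebra ℂ A]

theorem sum_nu_of_lt (u v : A) : ∀ {m N : ℕ}, m ≠ 0 → m < 2 * N →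
    ∑ r ∈ Finset.range N, algebraMap ℂ A (nu m r) * (u * v) ^ r * (u + v) ^ (m - 2 * r) =
      u ^ m + v ^ m
  | 0, _, hm, _ => absurd rfl hm
  | _ + 1, 0, _, h => absurd h (Nat.not_lt_zero _)
  | 1, N + 1, hm, _ => by
    rw [Finset.sum_range_succ', Finset.sum_eq_zero fun r _ => by
      rw [nu_eq_zero (by lia), map_zero, zero_mul, zero_mul], nu_zero hm]
    simp
  | 2, 1, _, h => absurd h (by lia)
  | 2, N + 2, hm, _ => by
    rw [Finset.sum_range_succ', Finset.sum_range_succ', Finset.sum_eq_zero fun r _ => by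
      rw [nu_eq_zero (by lia), map_zero, zero_mul, zero_mul], nu_zero hm, nu_two_one]
    simp only [map_neg, map_ofNat, map_one]
    ring
  | m + 3, N + 1, hm, h => by
    have hpow : u ^ (m + 3) + v ^ (m + 3) =
        (u + v) * (u ^ (m + 2) + v ^ (m + 2)) - u * v * (u ^ (m + 1) + v ^ (m + 1)) := by ring
    rw [hpow, ← sum_nu_of_lt u v (m := m + 2) (N := N + 1) (by lia) (by lia),
      ← sum_nu_of_lt u v (m := m + 1) (N := N) (by lia) (by lia), Finset.sum_range_succ',
      Finset.sum_range_succ', mul_add, Finset.mul_sum, Finset.mul_sum, add_sub_right_comm,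
      ← Finset.sum_sub_distrib, nu_zero hm, nu_zero (m := m + 2) (by lia)]
    congr 1
    · refine Finset.sum_congr rfl fun r _ => ?_
      rw [nu_add_two (by lia), map_sub, show m + 3 - 2 * (r + 1) = m + 1 - 2 * r by lia]
      rcases Nat.lt_or_ge (m + 2) (2 * (r + 1)) with hr | hr
      · rw [nu_eq_zero hr, map_zero]
        ring
      · rw [show m + 1 - 2 * r = m + 2 - 2 * (r + 1) + 1 by lia]
        ring
    · simp only [mul_zero, Nat.sub_zero]
      ring

theorem sum_nu {m : ℕ} (hm : m ≠ 0) (u v : A) : ∑ r ∈ Finset.range (m / 2 + 1),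
    algebraMap ℂ A (nu m r) * (u * v) ^ r * (u + v) ^ (m - 2 * r) = u ^ m + v ^ m :=
  sum_nu_of_lt u v hm (by lia)

end PowerSums

section Center

variable {ℓ : ℕ}

theorem weight_card_nsmul (p : Fin n → ℤ) (g : diagGroup n ℓ) : weight (ℓ • p) g = 1 := by
  have hg : g ^ ℓ = 1 := Subtype.ext g.2.2
  rw [weight_nsmul, ← map_pow, hg, map_one]

variable [NeZero ℓ] {ζ : ℂ} (hζ : IsPrimitiveRoot ζ ℓ)

theorem coefAt_mon_mul (p q : Fin n → ℤ) (g : diagGroup n ℓ) (a : Torus n hζ) :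
    coefAt hζ (p + q) g (mon hζ q 1 * a) = coefAt hζ p g a := by
  induction a using torus_induction with
  | h0 => rw [mul_zero, map_zero, map_zero]
  | hadd a b ha hb => rw [mul_add, map_add, map_add, ha, hb]
  | hm c p' g' =>
    rw [mul_smul_comm, mon_one_mul_mon, map_smul, map_smul, coefAt_mon, coefAt_mon, add_comm q]
    simp only [add_left_inj]

theorem coefAt_mul_mon (p q : Fin n → ℤ) (g : diagGroup n ℓ) (a : Torus n hζ) :
    coefAt hζ (p + q) g (a * mon hζ q 1) = weight q g * coefAt hζ p g a := by
  induction a using torus_induction with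
  | h0 => rw [zero_mul, map_zero, map_zero, mul_zero]
  | hadd a b ha hb => rw [add_mul, map_add, map_add, ha, hb, mul_add]
  | hm c p' g' =>
    rw [smul_mul_assoc, mon_mul_mon_one, map_smul, map_smul, map_smul, coefAt_mon, coefAt_mon,
      smul_eq_mul, smul_eq_mul, smul_eq_mul, mul_left_comm]
    simp only [add_left_inj]
    split_ifs with h
    · rw [h.2]
    · simp only [mul_zero]

theorem coefAt_grp_mul (p : Fin n → ℤ) (h : diagGroup n ℓ) (a : Torus n hζ) :
    coefAt hζ p h (mon hζ 0 h * a) = weight p h * coefAt hζ p 1 a := by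
  induction a using torus_induction with
  | h0 => rw [mul_zero, map_zero, map_zero, mul_zero]
  | hadd a b ha hb => rw [mul_add, map_add, map_add, ha, hb, mul_add]
  | hm c p' g' =>
    rw [mul_smul_comm, mon_mul_mon, map_smul, map_smul, map_smul, coefAt_mon, coefAt_mon,
      zero_add, smul_eq_mul, smul_eq_mul, smul_eq_mul, mul_left_comm]
    simp only [left_eq_mul, eq_comm (a := (1 : diagGroup n ℓ))]
    split_ifs with h
    · rw [h.1, h.2, twist_one]
    · simp only [mul_zero]

theorem coefAt_mul_grp (p : Fin n → ℤ) (h : diagGroup n ℓ) (a : Torus n hζ) :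
    coefAt hζ p h (a * mon hζ 0 h) = coefAt hζ p 1 a := by
  induction a using torus_induction with
  | h0 => rw [zero_mul, map_zero, map_zero]
  | hadd a b ha hb => rw [add_mul, map_add, map_add, ha, hb]
  | hm c p' g' =>
    rw [smul_mul_assoc, mon_mul_mon, map_smul, map_smul, map_smul, coefAt_mon, coefAt_mon,
      add_zero]
    simp only [right_eq_mul, eq_comm (a := (1 : diagGroup n ℓ))]
    split_ifs with h
    · rw [h.2, map_one, Units.val_one, one_smul]
    · simp only [smul_zero]

variable [NeZero n]

theorem weight_gen (p : Fin n → ℤ) (i : Fin n) :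
    weight p (gen hζ i) = zetaUnit hζ ^ (p i - p (i + 1)) := by
  have hprod (k : Fin n) :
      ∏ j, zetaUnit hζ ^ (((if j = k then 1 else 0) : ℤ) * p j) = zetaUnit hζ ^ p k := by
    rw [Finset.prod_eq_single k] <;> simp +contextual
  rw [weight_apply, zpow_sub, ← hprod i, ← hprod (i + 1), ← div_eq_mul_inv,
    ← Finset.prod_div_distrib]
  refine Finset.prod_congr rfl fun j _ => ?_
  rw [entryUnit_gen, ← zpow_mul, sub_mul, zpow_sub, div_eq_mul_inv]

include hζ in
theorem emod_eq_of_weight {p : Fin n → ℤ} (h : ∀ g : diagGroup n ℓ, weight p g = 1)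
    (j : Fin n) : p j % ℓ = p 0 % ℓ := by
  have hsucc (i : Fin n) : p (i + 1) % ℓ = p i % ℓ := by
    have hone := congrArg Units.val (h (gen hζ i))
    rw [weight_gen, Units.val_zpow_eq_zpow_val, coe_zetaUnit, Units.val_one,
      hζ.zpow_eq_one_iff_dvd] at hone
    exact Int.modEq_iff_dvd.2 hone
  obtain ⟨j, hj⟩ := j
  induction j with
  | zero => rfl
  | succ j ih =>
    have heq : (⟨j + 1, hj⟩ : Fin n) = ⟨j, by lia⟩ + 1 := by
      rw [Fin.ext_iff, val_add_one, if_neg (by lia)]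
    rw [heq, hsucc, ih]

variable (t : Fin n → ℂ)

theorem torusGen_pow_mem_center (hn : 2 ≤ n) (i : Fin n) :
    torusGen hζ t i ^ ℓ ∈ Subalgebra.center ℂ (Torus n hζ) := by
  obtain ⟨j, rfl⟩ : ∃ j, i = j + 1 := ⟨i - 1, by rw [sub_add_cancel]⟩
  rw [torusGen_pow hζ hn]
  refine Subalgebra.sub_mem _ (mem_center_of_weight hζ (weight_card_nsmul _))
    (Subalgebra.smul_mem _ (mem_center_of_weight hζ fun g => ?_) _)
  rw [weight_neg, weight_card_nsmul, inv_one]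

omit [NeZero n] in
theorem torusW_mem_center : torusW hζ t ∈ Subalgebra.center ℂ (Torus n hζ) := by
  refine Subalgebra.add_mem _ (mem_center_of_weight hζ weight_one)
    (Subalgebra.smul_mem _ (mem_center_of_weight hζ fun g => ?_) _)
  rw [weight_neg, weight_one, inv_one]

end Center

section PolyToCenter

variable [NeZero n] {ℓ : ℕ} [NeZero ℓ] {ζ : ℂ} (hn : 3 ≤ n) (hζ1 : ζ ≠ 1)
  (hζ : IsPrimitiveRoot ζ ℓ) (t : Fin n → ℂ)

include hn hζ1

theorem mem_center_of_heckeToTorus_mem_center {a : Hecke hζ t}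
    (h : heckeToTorus hn hζ1 hζ t a ∈ Subalgebra.center ℂ (Torus n hζ)) :
    a ∈ Subalgebra.center ℂ (Hecke hζ t) := by
  rw [Subalgebra.mem_center_iff] at h ⊢
  intro b
  apply heckeToTorus_injective hn hζ1 hζ t
  rw [map_mul, map_mul, h]

theorem heckeX_pow_mem_center (i : Fin n) :
    heckeX hζ t i ^ ℓ ∈ Subalgebra.center ℂ (Hecke hζ t) := by
  apply mem_center_of_heckeToTorus_mem_center hn hζ1 hζ t
  rw [map_pow, heckeToTorus_heckeX]
  exact torusGen_pow_mem_center hζ t (by lia) i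

theorem heckeW_mem_center : heckeW hζ t ∈ Subalgebra.center ℂ (Hecke hζ t) := by
  apply mem_center_of_heckeToTorus_mem_center hn hζ1 hζ t
  rw [heckeToTorus_heckeW]
  exact torusW_mem_center hζ t

/-- The homomorphism `a_i ↦ x_i ^ ℓ`, `b ↦ w` from the polynomial ring to the center of the Hecke
algebra. -/
def polyToCenter : MvPolynomial (Option (Fin n)) ℂ →ₐ[ℂ] Subalgebra.center ℂ (Hecke hζ t) :=
  MvPolynomial.aeval fun o => o.elim ⟨_, heckeW_mem_center hn hζ1 hζ t⟩
    fun i => ⟨_, heckeX_pow_mem_center hn hζ1 hζ t i⟩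

theorem polyToCenter_X_some (i : Fin n) :
    (polyToCenter hn hζ1 hζ t (MvPolynomial.X (some i)) : Hecke hζ t) = heckeX hζ t i ^ ℓ := by
  rw [polyToCenter, MvPolynomial.aeval_X]
  rfl

theorem polyToCenter_X_none :
    (polyToCenter hn hζ1 hζ t (MvPolynomial.X none) : Hecke hζ t) = heckeW hζ t := by
  rw [polyToCenter, MvPolynomial.aeval_X]
  rfl

end PolyToCenter

section Relation

variable [NeZero n] {ℓ : ℕ} {ζ : ℂ} (t : Fin n → ℂ)

theorem prod_tauTilde : ∏ i, tauTilde ℓ ζ t i = (-1) ^ (n * (ℓ - 1)) * (∏ i, tau ζ t i) ^ ℓ := by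
  obtain ⟨m, rfl⟩ := Nat.exists_eq_add_one_of_ne_zero (NeZero.ne n)
  rw [Fin.prod_univ_castSucc, Fin.prod_univ_castSucc, tauTilde, if_pos (by simp), mul_left_comm,
    mul_pow, ← Finset.prod_pow]
  congr 2
  refine Finset.prod_congr rfl fun i _ => ?_
  rw [tauTilde, if_neg]
  simpa using i.is_lt.ne

theorem pow_eq_neg_one_pow_mul_prod_tauTilde [NeZero ℓ] (hζ : IsPrimitiveRoot ζ ℓ) :
    ((-1) ^ n * ζ ^ (n - 2) * ∏ i, tau ζ t i) ^ ℓ = (-1) ^ n * ∏ i, tauTilde ℓ ζ t i := by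
  have hsign : n * ℓ = n + n * (ℓ - 1) := by
    rw [Nat.mul_sub, mul_one, Nat.add_sub_cancel' (Nat.le_mul_of_pos_right n (NeZero.pos ℓ))]
  rw [prod_tauTilde, mul_pow, mul_pow, ← pow_mul ζ, mul_comm (n - 2), pow_mul ζ, hζ.pow_eq_one,
    one_pow, mul_one, ← pow_mul, hsign, pow_add, mul_assoc]

variable {A : Type*} [CommRing A] [Algebra ℂ A] (f : MvPolynomial (Option (Fin n)) ℂ →ₐ[ℂ] A)

theorem map_sum_indexJ (hn : 3 ≤ n) {X Y : Fin n → A} {c : Fin n → ℂ}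
    (hXY : ∀ i, X i * Y i = algebraMap ℂ A (c i))
    (hx : ∀ j, f (MvPolynomial.X (some j)) = X j - Y (j - 1)) :
    f (∑ S ∈ indexJ n, MvPolynomial.C (∏ i ∈ S, c i) *
      ∏ j, MvPolynomial.X (some j) ^ (deltaSub S j).toNat) = ∏ i, X i + (-1) ^ n * ∏ i, Y i := by
  have hcomm : CyclicallyCommuting X Y :=
    ⟨fun _ _ => Commute.all _ _, fun _ _ => Commute.all _ _, fun _ _ _ _ => Commute.all _ _⟩
  have hs (i : Fin n) :
      algebraMap ℂ A (c i) = if i.val + 1 = n then Y i * X i else X i * Y i := by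
    rw [mul_comm (Y i), ite_self, hXY]
  rw [← List.prod_ofFn, ← List.prod_ofFn, ← hcomm.sum_indexJ hn hx hs, map_sum]
  refine Finset.sum_congr rfl fun S _ => ?_
  rw [map_mul, MvPolynomial.algHom_C, map_prod f, map_prod (algebraMap ℂ A), List.prod_ofFn,
    mul_comm, ((Finset.sort_perm_toList S _).map _).prod_eq, Finset.prod_map_toList]
  simp only [map_pow]

omit [NeZero n] in
theorem map_sum_nu [NeZero ℓ] {U V : A} {c : ℂ} (hUV : U * V = algebraMap ℂ A c)
    (hw : f (MvPolynomial.X none) = U + V) :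
    f (∑ r ∈ Finset.range (ℓ / 2 + 1),
      MvPolynomial.C (nu ℓ r * c ^ r) * MvPolynomial.X none ^ (ℓ - 2 * r)) = U ^ ℓ + V ^ ℓ := by
  rw [← sum_nu (NeZero.ne ℓ), map_sum]
  refine Finset.sum_congr rfl fun r _ => ?_
  rw [map_mul, map_pow, hw, MvPolynomial.algHom_C, hUV, map_mul, map_pow]

theorem map_relF [NeZero ℓ] (hn : 3 ≤ n) {X Y : Fin n → A} {U V : A}
    (hXY : ∀ i, X i * Y i = algebraMap ℂ A (tauTilde ℓ ζ t i))
    (hUV : U * V = algebraMap ℂ A ((-1) ^ n * ζ ^ (n - 2) * ∏ i, tau ζ t i))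
    (hx : ∀ j, f (MvPolynomial.X (some j)) = X j - Y (j - 1))
    (hw : f (MvPolynomial.X none) = U + V) :
    f (relF ℓ ζ t) = ∏ i, X i + (-1) ^ n * ∏ i, Y i - (U ^ ℓ + V ^ ℓ) := by
  rw [relF, map_sub, map_sum_indexJ f hn hXY hx, ← map_sum_nu f hUV hw]
  refine congrArg (_ - f ·) (Finset.sum_congr rfl fun r _ => ?_)
  congr 2
  rw [mul_pow, mul_pow, ← pow_mul, ← pow_mul]
  ring

/-- The homomorphism from the polynomial ring to the ring of Laurent polynomials which describes
the elements `x_i ^ ℓ` and `w` of the quantum torus. -/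
def polyToLaurent (ℓ : ℕ) (ζ : ℂ) (t : Fin n → ℂ) :
    MvPolynomial (Option (Fin n)) ℂ →ₐ[ℂ] AddMonoidAlgebra ℂ (Fin n → ℤ) :=
  MvPolynomial.aeval fun o => o.elim
    (AddMonoidAlgebra.single 1 1 +
      AddMonoidAlgebra.single (-1) ((-1) ^ n * ζ ^ (n - 2) * ∏ i, tau ζ t i))
    fun j => AddMonoidAlgebra.single (ℓ • Pi.single j 1) 1 -
      AddMonoidAlgebra.single (-(ℓ • Pi.single (j - 1) 1)) (tauTilde ℓ ζ t (j - 1))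

theorem polyToLaurent_X_some (j : Fin n) : polyToLaurent ℓ ζ t (MvPolynomial.X (some j)) =
    AddMonoidAlgebra.single (ℓ • Pi.single j 1) 1 -
      AddMonoidAlgebra.single (-(ℓ • Pi.single (j - 1) 1)) (tauTilde ℓ ζ t (j - 1)) :=
  MvPolynomial.aeval_X _ _

theorem polyToLaurent_X_none : polyToLaurent ℓ ζ t (MvPolynomial.X none) =
    AddMonoidAlgebra.single 1 1 +
      AddMonoidAlgebra.single (-1) ((-1) ^ n * ζ ^ (n - 2) * ∏ i, tau ζ t i) :=
  MvPolynomial.aeval_X _ _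

theorem polyToLaurent_relF [NeZero ℓ] (hn : 3 ≤ n) (hζ : IsPrimitiveRoot ζ ℓ) :
    polyToLaurent ℓ ζ t (relF ℓ ζ t) = 0 := by
  have hsum : ∑ i : Fin n, Pi.single i (1 : ℤ) = 1 := Finset.univ_sum_single 1
  have hinv (p : Fin n → ℤ) (c : ℂ) : AddMonoidAlgebra.single p 1 *
      AddMonoidAlgebra.single (-p) c = algebraMap ℂ (AddMonoidAlgebra ℂ (Fin n → ℤ)) c := by
    rw [AddMonoidAlgebra.single_mul_single, add_neg_cancel, one_mul]
    rfl
  have hsign : (-1 : AddMonoidAlgebra ℂ (Fin n → ℤ)) ^ n = algebraMap ℂ _ ((-1) ^ n) := by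
    rw [map_pow, map_neg, map_one]
  rw [map_relF t (polyToLaurent ℓ ζ t) hn (fun _ => hinv _ _) (hinv _ _) (polyToLaurent_X_some t)
    (polyToLaurent_X_none t), AddMonoidAlgebra.prod_single, AddMonoidAlgebra.prod_single,
    AddMonoidAlgebra.single_pow, AddMonoidAlgebra.single_pow,
    pow_eq_neg_one_pow_mul_prod_tauTilde t hζ, Finset.sum_neg_distrib, ← Finset.smul_sum, hsum,
    Finset.prod_const_one, one_pow, smul_neg, hsign, ← Algebra.smul_def,
    AddMonoidAlgebra.smul_single, smul_eq_mul, sub_self]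

end Relation

section LeadingExponents

variable {ℓ : ℕ}

/-- The exponent of the leading term of the image of a monomial in the quantum torus. -/
def leadExp (ℓ : ℕ) (m : Option (Fin n) →₀ ℕ) : Fin n → ℤ :=
  fun j => ℓ * m (some j) + m none

theorem leadExp_zero : leadExp ℓ (0 : Option (Fin n) →₀ ℕ) = 0 := by
  ext
  simp [leadExp]

theorem leadExp_add (m m' : Option (Fin n) →₀ ℕ) :
    leadExp ℓ (m + m') = leadExp ℓ m + leadExp ℓ m' := by
  ext
  simp only [leadExp, Finsupp.add_apply, Pi.add_apply, Nat.cast_add]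
  ring

theorem leadExp_single_none (k : ℕ) :
    leadExp ℓ (Finsupp.single none k : Option (Fin n) →₀ ℕ) = k • 1 := by
  ext
  simp [leadExp]

theorem leadExp_single_some (i : Fin n) (k : ℕ) :
    leadExp ℓ (Finsupp.single (some i) k) = k • ℓ • Pi.single i 1 := by
  ext j
  simp [leadExp, Finsupp.single_apply, Pi.single_apply, eq_comm (a := i), mul_comm]

theorem leadExp_injOn [NeZero n] [NeZero ℓ] : Set.InjOn (leadExp (n := n) ℓ) {m | m none < ℓ} := by
  intro m (hm : m none < ℓ) m' (hm' : m' none < ℓ) h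
  have hentry (j : Fin n) : ℓ * m (some j) + m none = ℓ * m' (some j) + m' none := by
    have := congrFun h j
    rw [leadExp, leadExp] at this
    exact_mod_cast this
  have hnone : m none = m' none := by
    have := congrArg (· % ℓ) (hentry 0)
    simpa only [Nat.mul_add_mod, Nat.mod_eq_of_lt hm, Nat.mod_eq_of_lt hm'] using this
  ext (_ | j)
  · exact hnone
  · have := hentry j
    rw [hnone, add_left_inj] at this
    exact Nat.eq_of_mul_eq_mul_left (NeZero.pos ℓ) this

end LeadingExponents

section PolyToTorus

variable {ℓ : ℕ} [NeZero ℓ] {ζ : ℂ} (hζ : IsPrimitiveRoot ζ ℓ)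

/-- The inclusion of the ring of Laurent polynomials in the quantum torus. -/
def laurentToTorus : AddMonoidAlgebra ℂ (Fin n → ℤ) →ₐ[ℂ] Torus n hζ :=
  AddMonoidAlgebra.lift ℂ _ _
    { toFun := fun p => mon hζ p.toAdd 1
      map_one' := mon_zero_one hζ
      map_mul' := fun p q => (mon_one_mul_mon hζ p.toAdd q.toAdd 1).symm }

theorem laurentToTorus_single (p : Fin n → ℤ) (c : ℂ) :
    laurentToTorus hζ (AddMonoidAlgebra.single p c) = c • mon hζ p 1 :=
  AddMonoidAlgebra.lift_single _ _ _

variable [NeZero n] (t : Fin n → ℂ)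

/-- The homomorphism `a_i ↦ x_i ^ ℓ`, `b ↦ w` from the polynomial ring to the quantum torus. -/
def polyToTorus : MvPolynomial (Option (Fin n)) ℂ →ₐ[ℂ] Torus n hζ :=
  (laurentToTorus hζ).comp (polyToLaurent ℓ ζ t)

theorem polyToTorus_X_some (hn : 2 ≤ n) (i : Fin n) :
    polyToTorus hζ t (MvPolynomial.X (some i)) = torusGen hζ t i ^ ℓ := by
  rw [polyToTorus, AlgHom.comp_apply, polyToLaurent_X_some, map_sub, laurentToTorus_single,
    laurentToTorus_single, one_smul]
  simpa only [sub_add_cancel] using (torusGen_pow hζ hn t (i - 1)).symm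

theorem polyToTorus_X_none : polyToTorus hζ t (MvPolynomial.X none) = torusW hζ t := by
  rw [polyToTorus, AlgHom.comp_apply, polyToLaurent_X_none, map_add, laurentToTorus_single,
    laurentToTorus_single, one_smul, torusW]

omit [NeZero n] in
theorem hasLead_torusW (hn : n ≠ 0) : HasLead (torusW hζ t) 1 1 := by
  rw [HasLead, torusW, add_sub_cancel_left]
  refine Submodule.smul_mem _ _ (mon_mem_fil ?_ _)
  rw [totalDeg_neg, totalDeg_one]
  lia

theorem hasLead_monomial (hn : 2 ≤ n) (m : Option (Fin n) →₀ ℕ) :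
    HasLead (polyToTorus hζ t (MvPolynomial.monomial m 1)) (leadExp ℓ m) 1 := by
  induction m using Finsupp.induction_linear with
  | zero =>
    rw [leadExp_zero, MvPolynomial.monomial_zero', map_one, map_one, ← mon_zero_one]
    exact hasLead_mon _ _
  | add m m' h h' =>
    rw [leadExp_add, ← one_mul (1 : ℂ), ← MvPolynomial.monomial_mul, map_mul]
    exact h.mul h'
  | single o k =>
    rw [← MvPolynomial.X_pow_eq_monomial, map_pow]
    cases o with
    | none =>
      rw [leadExp_single_none, polyToTorus_X_none]
      exact (hasLead_torusW hζ t (by lia)).pow k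
    | some i =>
      rw [leadExp_single_some, polyToTorus_X_some hζ t hn]
      exact ((hasLead_torusGen hζ t i).pow ℓ).pow k

theorem eq_zero_of_polyToTorus_eq_zero (hn : 2 ≤ n) {f : MvPolynomial (Option (Fin n)) ℂ}
    (hf : ∀ m ∈ f.support, m none < ℓ) (h : polyToTorus hζ t f = 0) : f = 0 := by
  have hli : LinearIndependent ℂ fun m : {m : Option (Fin n) →₀ ℕ // m none < ℓ} =>
      polyToTorus hζ t (MvPolynomial.monomial m.1 1) := by
    refine linearIndependent_of_hasLead (e := fun m => (leadExp ℓ m.1, 1)) ?_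
      fun m => hasLead_monomial hζ t hn m.1
    rintro ⟨m, hm⟩ ⟨m', hm'⟩ h
    exact Subtype.ext (leadExp_injOn hm hm' (Prod.ext_iff.1 h).1)
  have hsum : ∑ m ∈ f.support.subtype (fun m => m none < ℓ),
      f.coeff m.1 • polyToTorus hζ t (MvPolynomial.monomial m.1 1) = 0 := by
    rw [Finset.sum_subtype_of_mem (fun m => f.coeff m •
      polyToTorus hζ t (MvPolynomial.monomial m 1)) hf, ← h]
    conv_rhs => rw [f.as_sum, map_sum]
    refine Finset.sum_congr rfl fun m _ => ?_
    rw [← map_smul, MvPolynomial.smul_monomial, smul_eq_mul, mul_one]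
  rw [← MvPolynomial.support_eq_empty, Finset.eq_empty_iff_forall_notMem]
  intro m hm
  exact MvPolynomial.mem_support_iff.1 hm
    (linearIndependent_iff'.1 hli _ _ hsum ⟨m, hf m hm⟩ (Finset.mem_subtype.2 hm))

end PolyToTorus

section DivisionByRelF

open Polynomial

variable [NeZero n] {ℓ : ℕ} [NeZero ℓ] {ζ : ℂ} (t : Fin n → ℂ)

theorem neg_relF : -relF ℓ ζ t = MvPolynomial.X none ^ ℓ +
    (∑ r ∈ Finset.range (ℓ / 2),
      MvPolynomial.C ((-1) ^ (n * (r + 1)) * ζ ^ ((n - 2) * (r + 1)) * nu ℓ (r + 1) *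
        (∏ i, tau ζ t i) ^ (r + 1)) * MvPolynomial.X none ^ (ℓ - 2 * (r + 1)) -
    ∑ S ∈ indexJ n, MvPolynomial.C (∏ i ∈ S, tauTilde ℓ ζ t i) *
      ∏ j, MvPolynomial.X (some j) ^ (deltaSub S j).toNat) := by
  rw [relF, Finset.sum_range_succ', nu_zero (NeZero.ne ℓ)]
  simp only [mul_zero, pow_zero, mul_one, Nat.sub_zero, map_one, one_mul]
  ring

theorem exists_optionEquivLeft_neg_relF_eq :
    ∃ R : (MvPolynomial (Fin n) ℂ)[X], R.degree < ℓ ∧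
      MvPolynomial.optionEquivLeft ℂ (Fin n) (-relF ℓ ζ t) = X ^ ℓ + R := by
  set E := MvPolynomial.optionEquivLeft ℂ (Fin n)
  have hℓ := NeZero.pos ℓ
  refine ⟨_, ?_, by rw [neg_relF, map_add, map_pow, MvPolynomial.optionEquivLeft_X_none]⟩
  rw [← mem_degreeLT, map_sub, map_sum, map_sum]
  refine Submodule.sub_mem _ (Submodule.sum_mem _ fun r _ => ?_)
    (Submodule.sum_mem _ fun S _ => ?_)
  · rw [map_mul, map_pow, MvPolynomial.optionEquivLeft_X_none, MvPolynomial.optionEquivLeft_C,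
      mem_degreeLT]
    refine (degree_C_mul_X_pow_le _ _).trans_lt ?_
    exact_mod_cast (by lia : ℓ - 2 * (r + 1) < ℓ)
  · have hconst : E (MvPolynomial.C (∏ i ∈ S, tauTilde ℓ ζ t i) *
        ∏ j, MvPolynomial.X (some j) ^ (deltaSub S j).toNat) =
        C (MvPolynomial.C (∏ i ∈ S, tauTilde ℓ ζ t i) *
          ∏ j, MvPolynomial.X j ^ (deltaSub S j).toNat) := by
      rw [map_mul, MvPolynomial.optionEquivLeft_C, map_prod E, C_mul, map_prod C]
      simp only [map_pow, E, MvPolynomial.optionEquivLeft_X_some]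
    rw [hconst, mem_degreeLT]
    exact degree_C_le.trans_lt (by exact_mod_cast hℓ)

theorem exists_eq_add_relF_mul (f : MvPolynomial (Option (Fin n)) ℂ) :
    ∃ r q, f = r + relF ℓ ζ t * q ∧ ∀ m ∈ r.support, m none < ℓ := by
  -- up to sign, `F` is monic of degree `ℓ` in `b`
  set E := MvPolynomial.optionEquivLeft ℂ (Fin n) with hE
  obtain ⟨R, hR, hER⟩ := exists_optionEquivLeft_neg_relF_eq (ℓ := ℓ) (ζ := ζ) t
  have hmonic : (E (-relF ℓ ζ t)).Monic := by
    rw [hER]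
    exact monic_X_pow_add hR
  have hdeg : (E (-relF ℓ ζ t)).degree = ℓ := by
    rw [hER, degree_add_eq_left_of_degree_lt (by rwa [degree_X_pow]), degree_X_pow]
  refine ⟨E.symm (E f %ₘ E (-relF ℓ ζ t)), -E.symm (E f /ₘ E (-relF ℓ ζ t)), ?_, fun m hm => ?_⟩
  · apply E.injective
    rw [mul_neg, ← neg_mul, map_add, map_mul, E.apply_symm_apply, E.apply_symm_apply,
      modByMonic_add_div]
  · by_contra! hle
    rw [MvPolynomial.mem_support_iff, ← MvPolynomial.optionEquivLeft_coeff_some_coeff_none, ← hE,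
      E.apply_symm_apply, coeff_eq_zero_of_degree_lt, MvPolynomial.coeff_zero] at hm
    · exact hm rfl
    · refine (degree_modByMonic_lt (E f) hmonic).trans_le ?_
      rw [hdeg]
      exact_mod_cast hle

end DivisionByRelF

section Kernel

variable [NeZero n] {ℓ : ℕ} [NeZero ℓ] {ζ : ℂ} (hn : 3 ≤ n) (hζ1 : ζ ≠ 1)
  (hζ : IsPrimitiveRoot ζ ℓ) (t : Fin n → ℂ)

theorem heckeToTorus_polyToCenter (f : MvPolynomial (Option (Fin n)) ℂ) :
    heckeToTorus hn hζ1 hζ t (polyToCenter hn hζ1 hζ t f) = polyToTorus hζ t f := by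
  have hext : ((heckeToTorus hn hζ1 hζ t).comp (Subalgebra.val _)).comp
      (polyToCenter hn hζ1 hζ t) = polyToTorus hζ t := by
    apply MvPolynomial.algHom_ext
    rintro (_ | i)
    · rw [AlgHom.comp_apply, AlgHom.comp_apply, Subalgebra.val_apply, polyToCenter_X_none,
        heckeToTorus_heckeW, polyToTorus_X_none]
    · rw [AlgHom.comp_apply, AlgHom.comp_apply, Subalgebra.val_apply, polyToCenter_X_some, map_pow,
        heckeToTorus_heckeX, polyToTorus_X_some hζ t (by lia)]
  exact DFunLike.congr_fun hext f

theorem polyToCenter_eq_zero_iff {f : MvPolynomial (Option (Fin n)) ℂ} :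
    polyToCenter hn hζ1 hζ t f = 0 ↔ polyToTorus hζ t f = 0 := by
  rw [← heckeToTorus_polyToCenter hn hζ1, map_eq_zero_iff _ (heckeToTorus_injective hn hζ1 hζ t),
    ZeroMemClass.coe_eq_zero]

theorem ker_polyToCenter :
    RingHom.ker (polyToCenter hn hζ1 hζ t) = Ideal.span {relF ℓ ζ t} := by
  have hrelF : polyToTorus hζ t (relF ℓ ζ t) = 0 := by
    rw [polyToTorus, AlgHom.comp_apply, polyToLaurent_relF t hn hζ, map_zero]
  ext f
  rw [RingHom.mem_ker, polyToCenter_eq_zero_iff, Ideal.mem_span_singleton]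
  constructor
  · intro hf
    obtain ⟨r, q, rfl, hr⟩ := exists_eq_add_relF_mul (ℓ := ℓ) (ζ := ζ) t f
    rw [map_add, map_mul, hrelF, zero_mul, add_zero] at hf
    rw [eq_zero_of_polyToTorus_eq_zero hζ t (by lia) hr hf, zero_add]
    exact dvd_mul_right _ _
  · rintro ⟨q, rfl⟩
    rw [map_mul, hrelF, zero_mul]

end Kernel

section Surjectivity

variable [NeZero n] {ℓ : ℕ} [NeZero ℓ] {ζ : ℂ} {hζ : IsPrimitiveRoot ζ ℓ} {t : Fin n → ℂ}

theorem torusY_mem_fil (i : Fin n) : torusY hζ t i ∈ fil hζ (-1) :=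
  Submodule.smul_mem _ _ (mon_mem_fil (by rw [totalDeg_neg, totalDeg_single]) _)

theorem eq_one_of_coefAt_ne_zero {a : Torus n hζ} {d : ℤ} (ha : a ∈ fil hζ d)
    (hc : ∀ i, Commute a (torusGen hζ t i)) {p : Fin n → ℤ} {g : diagGroup n ℓ}
    (hp : totalDeg p = d) (h : coefAt hζ p g a ≠ 0) : g = 1 := by
  apply ext_entry
  intro i
  rw [entry_one]
  have hcomm := (hc i).eq
  rw [torusGen, mul_sub, sub_mul, sub_eq_sub_iff_add_eq_add] at hcomm
  have hcoef := congrArg (coefAt hζ (p + Pi.single i 1) g) hcomm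
  have hlt : d - 1 < totalDeg (p + Pi.single i 1) := by
    rw [totalDeg_add, totalDeg_single]
    lia
  rw [map_add, map_add,
    coefAt_eq_zero_of_mem_fil (mul_mem_fil ha (torusY_mem_fil _)) (by lia),
    coefAt_eq_zero_of_mem_fil (mul_mem_fil (torusY_mem_fil _) ha) (by lia), torusX,
    coefAt_mul_mon, coefAt_mon_mul, weight_single, zpow_one, coe_entryUnit, add_zero,
    add_zero] at hcoef
  exact mul_right_cancel₀ h (hcoef.trans (one_mul _).symm)

omit [NeZero n] in
theorem weight_eq_one_of_coefAt_ne_zero {a : Torus n hζ} {p : Fin n → ℤ}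
    (h : coefAt hζ p 1 a ≠ 0) {g : diagGroup n ℓ} (hc : Commute a (mon hζ 0 g)) :
    weight p g = 1 := by
  have hcoef := congrArg (coefAt hζ p g) hc.eq
  rw [coefAt_mul_grp, coefAt_grp_mul] at hcoef
  exact Units.ext (mul_right_cancel₀ h (hcoef.symm.trans (one_mul _).symm))

/-- The exponents of the monomial in the `a_i` and `b` whose image has leading exponent `p`. -/
def polyExp (ℓ : ℕ) (p : Fin n → ℤ) : Option (Fin n) →₀ ℕ :=
  Finsupp.equivFunOnFinite.symm fun o => o.elim (p 0 % ℓ).toNat fun j => (p j / ℓ).toNat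

theorem leadExp_polyExp {p : Fin n → ℤ} (h0 : 0 ≤ p) (h : ∀ j, p j % ℓ = p 0 % ℓ) :
    leadExp ℓ (polyExp ℓ p) = p := by
  have hℓ : (ℓ : ℤ) ≠ 0 := mod_cast NeZero.ne ℓ
  ext j
  change (ℓ : ℤ) * ((p j / ℓ).toNat : ℤ) + ((p 0 % ℓ).toNat : ℤ) = p j
  rw [Int.toNat_of_nonneg (Int.ediv_nonneg (h0 j) (by lia)),
    Int.toNat_of_nonneg (Int.emod_nonneg _ hℓ), ← h j, Int.mul_ediv_add_emod]

variable {hn : 3 ≤ n} {hζ1 : ζ ≠ 1}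

theorem exists_leadExp_eq_of_mem_center {z : Hecke hζ t}
    (hz : z ∈ Subalgebra.center ℂ (Hecke hζ t)) {d : ℤ}
    (hd : heckeToTorus hn hζ1 hζ t z ∈ fil hζ d) {p : Fin n → ℤ} {g : diagGroup n ℓ}
    (hp : totalDeg p = d) (h : coefAt hζ p g (heckeToTorus hn hζ1 hζ t z) ≠ 0) :
    g = 1 ∧ ∃ m, leadExp ℓ m = p := by
  have hcomm (b : Hecke hζ t) :
      Commute (heckeToTorus hn hζ1 hζ t z) (heckeToTorus hn hζ1 hζ t b) := by
    have hzb : Commute z b := (Subalgebra.mem_center_iff.1 hz b).symm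
    exact hzb.map (heckeToTorus hn hζ1 hζ t)
  obtain rfl : g = 1 := eq_one_of_coefAt_ne_zero (t := t) hd
    (fun i => by rw [← heckeToTorus_heckeX hn hζ1]; exact hcomm _) hp h
  refine ⟨rfl, polyExp ℓ p, leadExp_polyExp (zero_le_of_coefAt_heckeToTorus_ne_zero hd hp h)
    (emod_eq_of_weight hζ fun g => weight_eq_one_of_coefAt_ne_zero h ?_)⟩
  rw [← heckeToTorus_heckeGrp hn hζ1 hζ t]
  exact hcomm _

theorem exists_sub_polyToCenter_mem_fil {z : Subalgebra.center ℂ (Hecke hζ t)} {d : ℤ}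
    (hz : heckeToTorus hn hζ1 hζ t z ∈ fil hζ d) :
    ∃ f, heckeToTorus hn hζ1 hζ t ↑(z - polyToCenter hn hζ1 hζ t f) ∈ fil hζ (d - 1) := by
  obtain ⟨_, ⟨f, rfl⟩, hf⟩ := exists_mem_sub_mem_fil
    (W := LinearMap.range (polyToTorus hζ t).toLinearMap) hz fun p g hp h => by
      obtain ⟨rfl, m, rfl⟩ := exists_leadExp_eq_of_mem_center z.2 hz hp h
      exact ⟨_, ⟨_, rfl⟩, hasLead_monomial hζ t (by lia) m⟩
  refine ⟨f, ?_⟩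
  rw [AddSubgroupClass.coe_sub, map_sub, heckeToTorus_polyToCenter]
  exact hf

theorem mem_range_polyToCenter_of_mem_fil {d : ℕ} {z : Subalgebra.center ℂ (Hecke hζ t)}
    (hz : heckeToTorus hn hζ1 hζ t z ∈ fil hζ (d - 1)) :
    z ∈ (polyToCenter hn hζ1 hζ t).range := by
  induction d generalizing z with
  | zero =>
    have hz0 := heckeToTorus_eq_zero_of_mem_fil (by simp) hz
    rw [map_eq_zero_iff _ (heckeToTorus_injective hn hζ1 hζ t), ZeroMemClass.coe_eq_zero] at hz0
    rw [hz0]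
    exact Subalgebra.zero_mem _
  | succ d ih =>
    rw [Nat.cast_succ, add_sub_cancel_right] at hz
    obtain ⟨f, hf⟩ := exists_sub_polyToCenter_mem_fil hz
    have := Subalgebra.add_mem _ (ih hf) ⟨f, rfl⟩
    rwa [AlgHom.toRingHom_eq_coe, RingHom.coe_coe, sub_add_cancel] at this

end Surjectivity

theorem polyToCenter_surjective [NeZero n] {ℓ : ℕ} [NeZero ℓ] {ζ : ℂ} (hn : 3 ≤ n) (hζ1 : ζ ≠ 1)
    (hζ : IsPrimitiveRoot ζ ℓ) (t : Fin n → ℂ) :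
    Function.Surjective (polyToCenter hn hζ1 hζ t) := by
  intro z
  obtain ⟨d, hd⟩ := exists_mem_fil (heckeToTorus hn hζ1 hζ t z)
  exact mem_range_polyToCenter_of_mem_fil (d := d + 1) (by push_cast; rwa [add_sub_cancel_right])

theorem relF_zero [NeZero n] {ℓ : ℕ} [NeZero ℓ] (ζ : ℂ) :
    relF ℓ ζ (0 : Fin n → ℂ) = (∏ i, MvPolynomial.X (some i)) - MvPolynomial.X none ^ ℓ := by
  have htau (i : Fin n) : tau ζ 0 i = 0 := by simp [tau]
  have htauTilde (i : Fin n) : tauTilde ℓ ζ 0 i = 0 := by simp [tauTilde, htau, NeZero.ne ℓ]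
  have hprod : ∏ i : Fin n, tau ζ 0 i = 0 := Finset.prod_eq_zero (Finset.mem_univ 0) (htau 0)
  rw [relF, Finset.sum_eq_single ∅, Finset.sum_eq_single 0]
  · simp [deltaSub, nu_zero (NeZero.ne ℓ)]
  · intro r _ hr
    rw [hprod, zero_pow hr, mul_zero, map_zero, zero_mul]
  · simp
  · intro S _ hS
    obtain ⟨i, hi⟩ := Finset.nonempty_iff_ne_empty.2 hS
    rw [Finset.prod_eq_zero hi (htauTilde i), map_zero, zero_mul]
  · intro h
    exact absurd (by simp [indexJ]) h

end TwistedHecke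

end

theorem corollary3 (n ℓ : ℕ) [NeZero n] [NeZero ℓ] (hn : 3 ≤ n) (hℓ : 2 ≤ ℓ)
    (ζ : ℂ) (hζ : IsPrimitiveRoot ζ ℓ) (t : Fin n → ℂ) :
    (∃ φ : (MvPolynomial (Option (Fin n)) ℂ ⧸ Ideal.span {TwistedHecke.relF ℓ ζ t}) ≃ₐ[ℂ]
        Subalgebra.center ℂ (TwistedHecke.Hecke hζ t),
      (∀ i : Fin n, (φ (Ideal.Quotient.mk _ (MvPolynomial.X (some i))) :
          TwistedHecke.Hecke hζ t) = TwistedHecke.heckeX hζ t i ^ ℓ) ∧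
      (φ (Ideal.Quotient.mk _ (MvPolynomial.X none)) : TwistedHecke.Hecke hζ t) =
        TwistedHecke.heckeW hζ t) ∧
    ((∀ i, t i = 0) → TwistedHecke.relF ℓ ζ t =
      (∏ i : Fin n, MvPolynomial.X (some i)) - MvPolynomial.X none ^ ℓ) := by
  have hζ1 : ζ ≠ 1 := hζ.ne_one (by lia)
  let φ := (Ideal.quotientEquivAlgOfEq ℂ (TwistedHecke.ker_polyToCenter hn hζ1 hζ t).symm).trans
    (Ideal.quotientKerAlgEquivOfSurjective (TwistedHecke.polyToCenter_surjective hn hζ1 hζ t))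
  refine ⟨⟨φ, fun i => ?_, ?_⟩, fun ht => ?_⟩
  · exact TwistedHecke.polyToCenter_X_some hn hζ1 hζ t i
  · exact TwistedHecke.polyToCenter_X_none hn hζ1 hζ t
  · obtain rfl : t = 0 := funext ht
    exact TwistedHecke.relF_zero ζ
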